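/- A combinatorial $d$-cube is a convex polytope in $\mathbb{R}^d$ whose face lattice is isomorphic to that of the regular cube $[0,1]^d$. A triangulation of a polytope $C\subset\mathbb{R}^d$ is a finite set of $d$-simplices whose vertices are vertices of $C$, whose union is $C$, no two of which have an interior point in common, and any two of which intersect in a common (possibly empty) face; its size is the number of its $d$-simplices. For $d>2$ let $f(d)$ be the maximum size of a triangulation of $C$, taken over all combinatorial $d$-cubes $C$ and all triangulations of $C$ (this maximum exists). Then there is a constant $c\ge 1.031$, independent of $d$, such that $$f(d)\ \ge\ c^d\, d!\qquad\text{for every integer } d>2.$$ -/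

import Mathlib

/-- A convex polytope in `ℝ^d`: the convex hull of finitely many points. -/
def IsPolytope {d : ℕ} (P : Set (Fin d → ℝ)) : Prop :=
  ∃ V : Set (Fin d → ℝ), V.Finite ∧ P = convexHull ℝ V

/-- The faces of a polytope `P`, ordered by inclusion: the empty face, and the sets of points of
`P` at which some linear functional attains its maximum over `P` (the zero functional gives `P`
itself). -/
abbrev FaceLattice {d : ℕ} (P : Set (Fin d → ℝ)) : Type :=
  {F : Set (Fin d → ℝ) // IsExposed ℝ P F}

/-- The regular cube `[0,1]^d`. -/
def unitCube (d : ℕ) : Set (Fin d → ℝ) :=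
  Set.Icc 0 1

/-- A combinatorial `d`-cube: a convex polytope in `ℝ^d` whose face lattice is isomorphic to the
face lattice of the regular `d`-cube. -/
def IsCombinatorialCube (d : ℕ) (C : Set (Fin d → ℝ)) : Prop :=
  IsPolytope C ∧ Nonempty (FaceLattice C ≃o FaceLattice (unitCube d))

/-- A dissection of a point configuration `A` in `ℝ^d`: a finite set of `d`-simplices with vertices
in `A` (each given by its set of `d + 1` affinely independent vertices), no two of which have an
interior point in common, and whose union is the convex hull of `A`. -/
structure IsDissection {d : ℕ} (A : Set (Fin d → ℝ)) (T : Finset (Finset (Fin d → ℝ))) :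
    Prop where
  vertices_subset : ∀ s ∈ T, (s : Set (Fin d → ℝ)) ⊆ A
  card_eq : ∀ s ∈ T, s.card = d + 1
  affineIndependent : ∀ s ∈ T, AffineIndependent ℝ (fun x : s => (x : Fin d → ℝ))
  interior_disjoint : ∀ s ∈ T, ∀ t ∈ T, s ≠ t →
    Disjoint (interior (convexHull ℝ (s : Set (Fin d → ℝ))))
      (interior (convexHull ℝ (t : Set (Fin d → ℝ))))
  union_eq : (⋃ s ∈ T, convexHull ℝ (s : Set (Fin d → ℝ))) = convexHull ℝ A

/-- A triangulation of a point configuration: a dissection in which any two simplices intersect in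
a common (possibly empty) face. -/
structure IsTriangulation {d : ℕ} (A : Set (Fin d → ℝ)) (T : Finset (Finset (Fin d → ℝ))) : Prop
    extends IsDissection A T where
  inter_common_face : ∀ s ∈ T, ∀ t ∈ T, ∃ u : Finset (Fin d → ℝ), u ⊆ s ∧ u ⊆ t ∧
    convexHull ℝ (s : Set (Fin d → ℝ)) ∩ convexHull ℝ (t : Set (Fin d → ℝ)) =
      convexHull ℝ (u : Set (Fin d → ℝ))

/-- The sizes (numbers of `d`-simplices) of triangulations of combinatorial `d`-cubes, a
triangulation of a polytope being one of its set of vertices. -/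
def cubeTriangulationSizes (d : ℕ) : Set ℕ :=
  {n | ∃ C : Set (Fin d → ℝ), IsCombinatorialCube d C ∧
    ∃ T : Finset (Finset (Fin d → ℝ)), IsTriangulation (C.extremePoints ℝ) T ∧ T.card = n}

/-- The largest size of a triangulation of a combinatorial `d`-cube. -/
noncomputable def maxCubeTriangulationSize (d : ℕ) : ℕ :=
  sSup (cubeTriangulationSizes d)

/-! A triangulation of the unit cube has at most `d!` simplices, because each has volume at least
`1/d!`. A deformed cube escapes this bound: the prism over a trapezoid with parallel sides 1 and 2
is a combinatorial 3-cube and has a triangulation with 7 > 3! tetrahedra.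

Products carry the gain to all dimensions. The staircase triangulation of a product has size `n * m
* (a + b).choose a`, so size divided by `d!` is multiplicative (`HasCubeTriangulation.prod`). With
`d / 3` prisms and `d % 3` segments the ratio is `(7/6) ^ (d / 3)`, which is at least `1.031 ^ d`
for `d ≥ 3`.

Triangulations are handled through `IsRep`: every point of the polytope has exactly one convex
representation supported on a simplex of `T`. With the right number of vertices per simplex, this
yields all the triangulation axioms (`isTriangulation_of_existsUnique_isRep`). It passes to products
because a weight on a chain is the comonotone coupling of its marginals (`existsUnique_isRep_prod`).
Face lattices are read off from vertex-facet incidences (`HasIncidence.nonempty_orderIso`). -/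

/-- Nonnegative weights of total mass one with barycentre `x`, supported on a member of `T`. -/
structure IsRep {V E : Type*} [Fintype V] [AddCommGroup E] [Module ℝ E] (p : V → E)
    (T : Finset (Finset V)) (x : E) (w : V → ℝ) : Prop where
  nonneg : ∀ v, 0 ≤ w v
  sum_eq : ∑ v, w v = 1
  supp : ∃ s ∈ T, ∀ v ∉ s, w v = 0
  point : ∑ v, w v • p v = x

/-! ### Weights on chains and their marginals -/

theorem sum_fst_le {α β : Type*} [Fintype α] [Fintype β] [LinearOrder α]
    {w : α × β → ℝ} (a : α) :
    ∑ q with q.1 ≤ a, w q = ∑ x with x ≤ a, ∑ y, w (x, y) := by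
  rw [Finset.sum_filter, Finset.sum_filter, Fintype.sum_prod_type]
  refine Finset.sum_congr rfl fun x _ => ?_
  by_cases h : x ≤ a <;> simp [h]

theorem sum_snd_le {α β : Type*} [Fintype α] [Fintype β] [LinearOrder β]
    {w : α × β → ℝ} (b : β) :
    ∑ q with q.2 ≤ b, w q = ∑ y with y ≤ b, ∑ x, w (x, y) := by
  rw [Finset.sum_filter, Finset.sum_filter, Fintype.sum_prod_type_right]
  refine Finset.sum_congr rfl fun x _ => ?_
  by_cases h : x ≤ b <;> simp [h]

section Comonotone

variable {α β : Type*} [Fintype α] [Fintype β] [LinearOrder α] [LinearOrder β]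

-- If no support point has first coordinate at most `a` and second above `b`, the corner holds all
-- the mass of the first strip. Otherwise such a point `r` exists, and comparability with `r` puts
-- all the mass of the second strip into the corner.
open Classical in
theorem sum_le_eq_min_of_chain {w : α × β → ℝ} (h0 : ∀ q, 0 ≤ w q)
    (hc : ∀ q r, w q ≠ 0 → w r ≠ 0 → q ≤ r ∨ r ≤ q) (a : α) (b : β) :
    ∑ q with q ≤ (a, b), w q = min (∑ q with q.1 ≤ a, w q) (∑ q with q.2 ≤ b, w q) := by
  have hA : (Finset.univ.filter fun q : α × β => q ≤ (a, b)) ⊆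
      Finset.univ.filter fun q => q.1 ≤ a := by
    intro q; simp only [Finset.mem_filter, Finset.mem_univ, true_and]; exact fun h => h.1
  have hB : (Finset.univ.filter fun q : α × β => q ≤ (a, b)) ⊆
      Finset.univ.filter fun q => q.2 ≤ b := by
    intro q; simp only [Finset.mem_filter, Finset.mem_univ, true_and]; exact fun h => h.2
  have hA' := Finset.sum_le_sum_of_subset_of_nonneg hA (fun q _ _ => h0 q)
  have hB' := Finset.sum_le_sum_of_subset_of_nonneg hB (fun q _ _ => h0 q)
  by_cases h : ∀ q : α × β, q.1 ≤ a → w q ≠ 0 → q.2 ≤ b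
  · have : ∑ q with q ≤ (a, b), w q = ∑ q : α × β with q.1 ≤ a, w q := by
      apply Finset.sum_subset hA
      intro q hq hq'
      simp only [Finset.mem_filter, Finset.mem_univ, true_and] at hq hq'
      by_contra hw
      exact hq' ⟨hq, h q hq hw⟩
    rw [← this, min_eq_left hB']
  · push Not at h
    obtain ⟨r, hr1, hr0, hr2⟩ := h
    have : ∑ q with q ≤ (a, b), w q = ∑ q : α × β with q.2 ≤ b, w q := by
      apply Finset.sum_subset hB
      intro q hq hq'
      simp only [Finset.mem_filter, Finset.mem_univ, true_and] at hq hq'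
      by_contra hw
      rcases hc q r hw hr0 with h' | h'
      · exact hq' ⟨h'.1.trans hr1, hq⟩
      · exact absurd (h'.2.trans hq) (not_le.2 hr2)
    rw [← this, min_eq_right hA']

open Classical in
/-- A nonnegative weight supported on a chain of a product is determined by its marginals. -/
theorem eq_of_chain_of_marginals {w w' : α × β → ℝ} (h0 : ∀ q, 0 ≤ w q) (h0' : ∀ q, 0 ≤ w' q)
    (hc : ∀ q r, w q ≠ 0 → w r ≠ 0 → q ≤ r ∨ r ≤ q)
    (hc' : ∀ q r, w' q ≠ 0 → w' r ≠ 0 → q ≤ r ∨ r ≤ q)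
    (h1 : ∀ a, ∑ b, w (a, b) = ∑ b, w' (a, b)) (h2 : ∀ b, ∑ a, w (a, b) = ∑ a, w' (a, b)) :
    w = w' := by
  funext q
  induction q using WellFoundedLT.induction with
  | ind q ih =>
    obtain ⟨a, b⟩ := q
    -- The cumulative sums depend only on the marginals; well-founded induction then recovers the
    -- individual values.
    have key : ∑ q with q ≤ (a, b), w q = ∑ q with q ≤ (a, b), w' q := by
      rw [sum_le_eq_min_of_chain h0 hc, sum_le_eq_min_of_chain h0' hc', sum_fst_le, sum_fst_le,
        sum_snd_le, sum_snd_le]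
      simp only [h1, h2]
    have hs : (Finset.univ.filter fun q : α × β => q ≤ (a, b)) =
        insert (a, b) (Finset.univ.filter fun q => q < (a, b)) := by
      ext q
      simp [le_iff_eq_or_lt]
    rw [hs, Finset.sum_insert (by simp), Finset.sum_insert (by simp)] at key
    have : ∑ q with q < (a, b), w q = ∑ q with q < (a, b), w' q :=
      Finset.sum_congr rfl fun q hq => ih q (by simpa using hq)
    linarith

end Comonotone

/-! ### Staircases in a product of two chains -/

section Stair

variable {α β : Type*} [DecidableEq α] [DecidableEq β]

/-- The staircases (maximal chains) in the product of two chains, given by their sorted lists. -/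
def stair : List α → List β → Finset (Finset (α × β))
  | [], _ => ∅
  | _ :: _, [] => ∅
  | a :: l, b :: m =>
    if l = [] ∧ m = [] then {{(a, b)}}
    -- If one tail is empty, its branch of the union is empty.
    else (stair l (b :: m) ∪ stair (a :: l) m).image (insert (a, b))
termination_by l m => l.length + m.length

theorem stair_nil_right (l : List α) : stair l ([] : List β) = ∅ := by
  cases l <;> simp [stair]

/-- Recursion principle for membership in `stair`. -/
theorem stair_induction {motive : List α → List β → Finset (α × β) → Prop}
    (base : ∀ a b, motive [a] [b] {(a, b)})
    (left : ∀ a b l m σ, σ ∈ stair l (b :: m) → motive l (b :: m) σ →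
      motive (a :: l) (b :: m) (insert (a, b) σ))
    (right : ∀ a b l m σ, σ ∈ stair (a :: l) m → motive (a :: l) m σ →
      motive (a :: l) (b :: m) (insert (a, b) σ))
    (l : List α) (m : List β) (σ : Finset (α × β)) (h : σ ∈ stair l m) : motive l m σ := by
  induction hn : l.length + m.length using Nat.strong_induction_on generalizing l m σ with
  | _ n ih =>
    match l, m with
    | [], _ => simp [stair] at h
    | _ :: _, [] => simp [stair] at h
    | a :: l, b :: m =>
      rw [stair] at h
      split_ifs at h with hlm
      · obtain ⟨rfl, rfl⟩ := hlm
        rw [Finset.mem_singleton] at h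
        exact h ▸ base a b
      · rw [Finset.mem_image] at h
        obtain ⟨τ, hτ, rfl⟩ := h
        simp only [List.length_cons] at hn
        rcases Finset.mem_union.1 hτ with hτ | hτ
        · exact left a b l m τ hτ (ih _ (by simp; omega) _ _ _ hτ rfl)
        · exact right a b l m τ hτ (ih _ (by simp; omega) _ _ _ hτ rfl)

/-- A staircase remembers both of its factors; this is what makes staircases of different pairs of
simplices distinct. -/
theorem stair_image_fst {l : List α} {m : List β} {σ : Finset (α × β)} (h : σ ∈ stair l m) :
    σ.image Prod.fst = l.toFinset := by
  refine stair_induction (motive := fun l _ σ => σ.image Prod.fst = l.toFinset) ?_ ?_ ?_ l m σ h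
  · simp
  · intro a b l m σ _ ih
    simp [Finset.image_insert, ih]
  · intro a b l m σ _ ih
    simp [Finset.image_insert, ih]

theorem stair_image_snd {l : List α} {m : List β} {σ : Finset (α × β)} (h : σ ∈ stair l m) :
    σ.image Prod.snd = m.toFinset := by
  refine stair_induction (motive := fun _ m σ => σ.image Prod.snd = m.toFinset) ?_ ?_ ?_ l m σ h
  · simp
  · intro a b l m σ _ ih
    simp [Finset.image_insert, ih]
  · intro a b l m σ _ ih
    simp [Finset.image_insert, ih]

theorem fst_mem_of_stair {l : List α} {m : List β} {σ : Finset (α × β)} (h : σ ∈ stair l m)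
    {q : α × β} (hq : q ∈ σ) : q.1 ∈ l := by
  rw [← List.mem_toFinset, ← stair_image_fst h]
  exact Finset.mem_image_of_mem _ hq

theorem snd_mem_of_stair {l : List α} {m : List β} {σ : Finset (α × β)} (h : σ ∈ stair l m)
    {q : α × β} (hq : q ∈ σ) : q.2 ∈ m := by
  rw [← List.mem_toFinset, ← stair_image_snd h]
  exact Finset.mem_image_of_mem _ hq

theorem notMem_of_stair_left {a : α} {b : β} {l : List α} {m : List β} (hl : (a :: l).Nodup)
    {σ : Finset (α × β)} (h : σ ∈ stair l m) : (a, b) ∉ σ := fun hq =>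
  (List.nodup_cons.1 hl).1 (fst_mem_of_stair h hq)

theorem notMem_of_stair_right {a : α} {b : β} {l : List α} {m : List β} (hm : (b :: m).Nodup)
    {σ : Finset (α × β)} (h : σ ∈ stair l m) : (a, b) ∉ σ := fun hq =>
  (List.nodup_cons.1 hm).1 (snd_mem_of_stair h hq)

theorem card_of_stair {l : List α} {m : List β} {σ : Finset (α × β)} (h : σ ∈ stair l m) :
    l.Nodup → m.Nodup → σ.card + 1 = l.length + m.length := by
  refine stair_induction
    (motive := fun l m σ => l.Nodup → m.Nodup → σ.card + 1 = l.length + m.length) ?_ ?_ ?_ l m σ h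
  · simp
  · intro a b l m σ hσ ih hl hm
    rw [Finset.card_insert_of_notMem (notMem_of_stair_left hl hσ), ih hl.of_cons hm]
    simp; omega
  · intro a b l m σ hσ ih hl hm
    rw [Finset.card_insert_of_notMem (notMem_of_stair_right hm hσ), ih hl hm.of_cons]
    simp; omega

/-- Pascal's rule: after the corner `(a, b)` the staircase advances in one coordinate or the other.
The two kinds differ in whether `a` still occurs as a first coordinate. -/
theorem card_stair (a : α) (b : β) (l : List α) (m : List β) (hl : (a :: l).Nodup)
    (hm : (b :: m).Nodup) :
    (stair (a :: l) (b :: m)).card = (l.length + m.length).choose l.length := by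
  induction hn : l.length + m.length using Nat.strong_induction_on generalizing a b l m with
  | _ n ih =>
    rw [stair]
    split_ifs with hlm
    · obtain ⟨rfl, rfl⟩ := hlm
      simp at hn
      simp [← hn]
    · rw [Finset.card_image_of_injOn, Finset.card_union_of_disjoint]
      · rcases l with _ | ⟨a', l⟩
        · rcases m with _ | ⟨b', m⟩
          · simp at hlm
          · rw [ih m.length (by simp at hn; omega) a b' [] m (by simp) hm.of_cons (by simp)]
            simp [stair]
        · rcases m with _ | ⟨b', m⟩
          · rw [ih l.length (by simp at hn; omega) a' b l [] hl.of_cons (by simp) (by simp)]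
            simp [stair_nil_right, ← hn]
          · have hn' : n = (l.length + m.length + 1) + 1 := by simp at hn; omega
            rw [ih (l.length + m.length + 1) (by omega) a' b l (b' :: m) hl.of_cons hm
              (by simp; omega),
              ih (l.length + m.length + 1) (by omega) a b' (a' :: l) m hl hm.of_cons
              (by simp; omega), hn', List.length_cons,
              Nat.choose_succ_succ (l.length + m.length + 1)]
      · rw [Finset.disjoint_left]
        intro σ h1 h2
        have := stair_image_fst h2
        rw [stair_image_fst h1] at this
        have h3 : a ∈ (a :: l).toFinset := by simp
        rw [← this, List.mem_toFinset] at h3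
        exact (List.nodup_cons.1 hl).1 h3
      · have key : ∀ σ ∈ ((stair l (b :: m) ∪ stair (a :: l) m : Finset _) : Set (Finset (α × β))),
            (a, b) ∉ σ := by
          intro σ hσ
          rcases Finset.mem_union.1 (Finset.mem_coe.1 hσ) with hσ | hσ
          · exact notMem_of_stair_left hl hσ
          · exact notMem_of_stair_right hm hσ
        intro σ hσ τ hτ h
        rw [← Finset.erase_insert (key σ hσ), ← Finset.erase_insert (key τ hτ)]
        exact congrArg (fun s => Finset.erase s (a, b)) h

/-- Since the lists are sorted, each newly inserted corner lies below all later points. -/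
theorem chain_of_stair {α β : Type*} [LinearOrder α] [LinearOrder β] {l : List α} {m : List β}
    {σ : Finset (α × β)} (h : σ ∈ stair l m) :
    l.Pairwise (· ≤ ·) → m.Pairwise (· ≤ ·) → ∀ q ∈ σ, ∀ r ∈ σ, q ≤ r ∨ r ≤ q := by
  have aux : ∀ (a : α) (b : β) (l : List α) (m : List β) (σ : Finset (α × β)),
      (∀ q ∈ σ, q.1 ∈ a :: l ∧ q.2 ∈ b :: m) → (a :: l).Pairwise (· ≤ ·) →
      (b :: m).Pairwise (· ≤ ·) → (∀ q ∈ σ, ∀ r ∈ σ, q ≤ r ∨ r ≤ q) →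
      ∀ q ∈ insert (a, b) σ, ∀ r ∈ insert (a, b) σ, q ≤ r ∨ r ≤ q := by
    intro a b l m σ hσ hl hm ih
    have hle : ∀ q ∈ σ, (a, b) ≤ q := by
      intro q hq
      obtain ⟨h1, h2⟩ := hσ q hq
      refine ⟨?_, ?_⟩
      · rcases List.mem_cons.1 h1 with h | h
        · exact h.ge
        · exact (List.pairwise_cons.1 hl).1 _ h
      · rcases List.mem_cons.1 h2 with h | h
        · exact h.ge
        · exact (List.pairwise_cons.1 hm).1 _ h
    intro q hq r hr
    rcases Finset.mem_insert.1 hq with rfl | hq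
    · rcases Finset.mem_insert.1 hr with rfl | hr
      · exact Or.inl le_rfl
      · exact Or.inl (hle r hr)
    · rcases Finset.mem_insert.1 hr with rfl | hr
      · exact Or.inr (hle q hq)
      · exact ih q hq r hr
  refine stair_induction (motive := fun l m σ => l.Pairwise (· ≤ ·) → m.Pairwise (· ≤ ·) →
    ∀ q ∈ σ, ∀ r ∈ σ, q ≤ r ∨ r ≤ q) ?_ ?_ ?_ l m σ h
  · intro a b _ _ q hq r hr
    rw [Finset.mem_singleton] at hq hr
    exact Or.inl (by rw [hq, hr])
  · intro a b l m σ hσ ih hl hm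
    refine aux a b l m σ (fun q hq => ⟨List.mem_cons_of_mem _ (fst_mem_of_stair hσ hq),
      snd_mem_of_stair hσ hq⟩) hl hm (ih (List.pairwise_cons.1 hl).2 hm)
  · intro a b l m σ hσ ih hl hm
    refine aux a b l m σ (fun q hq => ⟨fst_mem_of_stair hσ hq,
      List.mem_cons_of_mem _ (snd_mem_of_stair hσ hq)⟩) hl hm (ih hl (List.pairwise_cons.1 hm).2)

/-- The comonotone coupling: two weights of equal mass on chains are the marginals of a weight
supported on a staircase. -/
theorem exists_stair_coupling [Fintype α] [Fintype β] (l : List α) (m : List β)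
    (hl : l ≠ []) (hm : m ≠ []) (f : α → ℝ) (g : β → ℝ) (hf : ∀ a, 0 ≤ f a) (hg : ∀ b, 0 ≤ g b)
    (hfl : ∀ a ∉ l, f a = 0) (hgm : ∀ b ∉ m, g b = 0) (hfg : ∑ a, f a = ∑ b, g b) :
    ∃ σ ∈ stair l m, ∃ w : α × β → ℝ, (∀ q, 0 ≤ w q) ∧ (∀ q ∉ σ, w q = 0) ∧
      (∀ a, ∑ b, w (a, b) = f a) ∧ ∀ b, ∑ a, w (a, b) = g b := by
  induction hn : l.length + m.length using Nat.strong_induction_on generalizing l m f g with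
  | _ n ih =>
    obtain ⟨a, l, rfl⟩ := List.exists_cons_of_ne_nil hl
    obtain ⟨b, m, rfl⟩ := List.exists_cons_of_ne_nil hm
    simp only [List.length_cons] at hn
    have hfa : l = [] → ∀ x, x ≠ a → f x = 0 := by
      rintro rfl x hx; exact hfl x (by simpa using hx)
    have hgb : m = [] → ∀ y, y ≠ b → g y = 0 := by
      rintro rfl y hy; exact hgm y (by simpa using hy)
    have hfs : l = [] → ∑ x, f x = f a := fun h =>
      Fintype.sum_eq_single a (hfa h)
    have hgs : m = [] → ∑ y, g y = g b := fun h =>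
      Fintype.sum_eq_single b (hgb h)
    have hfle : f a ≤ ∑ x, f x := Finset.single_le_sum (fun x _ => hf x) (Finset.mem_univ a)
    have hgle : g b ≤ ∑ x, g x := Finset.single_le_sum (fun x _ => hg x) (Finset.mem_univ b)
    -- Extends a coupling of the remaining masses by placing mass `c` on the corner.
    have add : ∀ (c : ℝ) (f' : α → ℝ) (g' : β → ℝ) (σ : Finset (α × β)) (w : α × β → ℝ), 0 ≤ c →
        f' + Pi.single a c = f → g' + Pi.single b c = g → (∀ q, 0 ≤ w q) → (∀ q ∉ σ, w q = 0) →
        (∀ x, ∑ y, w (x, y) = f' x) → (∀ y, ∑ x, w (x, y) = g' y) →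
        ∃ w : α × β → ℝ, (∀ q, 0 ≤ w q) ∧ (∀ q ∉ insert (a, b) σ, w q = 0) ∧
          (∀ a, ∑ b, w (a, b) = f a) ∧ ∀ b, ∑ a, w (a, b) = g b := by
      intro c f' g' σ w hc hf' hg' h0 hσ h1 h2
      refine ⟨w + Pi.single (a, b) c, ?_, ?_, ?_, ?_⟩
      · intro q
        have : (0 : α × β → ℝ) ≤ Pi.single (a, b) c := Pi.single_nonneg.2 hc
        exact add_nonneg (h0 q) (this q)
      · intro q hq
        rw [Finset.mem_insert, not_or] at hq
        simp [hσ q hq.2, hq.1]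
      · intro x
        rw [← hf']
        by_cases hx : x = a <;>
          simp [Finset.sum_add_distrib, h1, Pi.single_apply, hx]
      · intro x
        rw [← hg']
        by_cases hx : x = b <;>
          simp [Finset.sum_add_distrib, h2, Pi.single_apply, hx]
    by_cases hlm : l = [] ∧ m = []
    · refine ⟨{(a, b)}, by rw [stair, if_pos hlm]; simp, ?_⟩
      have hab : f a = g b := by rw [← hfs hlm.1, ← hgs hlm.2, hfg]
      refine add (f a) 0 0 ∅ 0 (hf a) ?_ ?_ (by simp) (by simp) (by simp) (by simp)
      · funext x
        by_cases hx : x = a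
        · subst hx; simp
        · simp [hx, hfa hlm.1 x hx]
      · funext x
        by_cases hx : x = b
        · subst hx; simp [hab]
        · simp [hx, hgb hlm.2 x hx]
    -- The smaller of the two head masses goes on the corner, and the head thus exhausted is
    -- dropped. If one list is a singleton, equality of total masses makes its head the larger, so
    -- the other list is the one to shrink.
    · have hcase : (l ≠ [] ∧ f a ≤ g b) ∨ (m ≠ [] ∧ g b ≤ f a) := by
        by_cases h1 : l = []
        · have h2 : m ≠ [] := fun h => hlm ⟨h1, h⟩
          exact Or.inr ⟨h2, by rw [← hfs h1, hfg]; exact hgle⟩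
        · by_cases h2 : m = []
          · exact Or.inl ⟨h1, by rw [← hgs h2, ← hfg]; exact hfle⟩
          · rcases le_total (f a) (g b) with h | h
            · exact Or.inl ⟨h1, h⟩
            · exact Or.inr ⟨h2, h⟩
      rw [stair, if_neg hlm]
      rcases hcase with ⟨hl', hab⟩ | ⟨hm', hab⟩
      · obtain ⟨σ, hσ, w, h0, h1, h2, h3⟩ := ih (l.length + (m.length + 1)) (by omega) l (b :: m) hl'
          (by simp) (f - Pi.single a (f a)) (g - Pi.single b (f a))
          (by
            intro x
            by_cases hx : x = a
            · subst hx; simp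
            · simp [hx, hf x])
          (by
            intro x
            by_cases hx : x = b
            · subst hx; simpa using hab
            · simp [hx, hg x])
          (by
            intro x hx
            by_cases hxa : x = a
            · subst hxa; simp
            · simp [hxa, hfl x (by simp [hxa, hx])])
          (by
            intro x hx
            have : x ≠ b := by rintro rfl; simp at hx
            simp [this, hgm x hx])
          (by simp [Finset.sum_sub_distrib, hfg]) (by simp)
        refine ⟨insert (a, b) σ, Finset.mem_image_of_mem _ (Finset.mem_union_left _ hσ), ?_⟩
        exact add (f a) _ _ σ w (hf a) (sub_add_cancel _ _) (sub_add_cancel _ _) h0 h1 h2 h3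
      · obtain ⟨σ, hσ, w, h0, h1, h2, h3⟩ := ih ((l.length + 1) + m.length) (by omega) (a :: l) m
          (by simp) hm' (f - Pi.single a (g b)) (g - Pi.single b (g b))
          (by
            intro x
            by_cases hx : x = a
            · subst hx; simpa using hab
            · simp [hx, hf x])
          (by
            intro x
            by_cases hx : x = b
            · subst hx; simp
            · simp [hx, hg x])
          (by
            intro x hx
            have : x ≠ a := by rintro rfl; simp at hx
            simp [this, hfl x hx])
          (by
            intro x hx
            by_cases hxa : x = b
            · subst hxa; simp
            · simp [hxa, hgm x (by simp [hxa, hx])])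
          (by simp [Finset.sum_sub_distrib, hfg]) (by simp)
        refine ⟨insert (a, b) σ, Finset.mem_image_of_mem _ (Finset.mem_union_right _ hσ), ?_⟩
        exact add (g b) _ _ σ w (hg b) (sub_add_cancel _ _) (sub_add_cancel _ _) h0 h1 h2 h3

end Stair

/-! ### The staircase triangulation of a product -/

section Product

variable {α β : Type*} [LinearOrder α] [LinearOrder β]

/-- The staircase triangulation of the product of two (abstract) triangulations. -/
def stairProduct (T : Finset (Finset α)) (U : Finset (Finset β)) : Finset (Finset (α × β)) :=
  (T ×ˢ U).biUnion fun st => stair (st.1.sort (· ≤ ·)) (st.2.sort (· ≤ ·))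

theorem mem_stairProduct {T : Finset (Finset α)} {U : Finset (Finset β)} {σ : Finset (α × β)} :
    σ ∈ stairProduct T U ↔ ∃ s ∈ T, ∃ t ∈ U, σ ∈ stair (s.sort (· ≤ ·)) (t.sort (· ≤ ·)) := by
  simp only [stairProduct, Finset.mem_biUnion, Finset.mem_product, Prod.exists]
  constructor
  · rintro ⟨s, t, ⟨hs, ht⟩, h⟩; exact ⟨s, hs, t, ht, h⟩
  · rintro ⟨s, hs, t, ht, h⟩; exact ⟨s, t, ⟨hs, ht⟩, h⟩

theorem card_of_mem_stairProduct {T : Finset (Finset α)} {U : Finset (Finset β)} {a b : ℕ}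
    (hT : ∀ s ∈ T, s.card = a + 1) (hU : ∀ t ∈ U, t.card = b + 1) {σ : Finset (α × β)}
    (h : σ ∈ stairProduct T U) : σ.card = a + b + 1 := by
  obtain ⟨s, hs, t, ht, h⟩ := mem_stairProduct.1 h
  have := card_of_stair h (Finset.sort_nodup _ _) (Finset.sort_nodup _ _)
  rw [Finset.length_sort, Finset.length_sort, hT s hs, hU t ht] at this
  omega

theorem card_stairProduct {T : Finset (Finset α)} {U : Finset (Finset β)} {a b : ℕ}
    (hT : ∀ s ∈ T, s.card = a + 1) (hU : ∀ t ∈ U, t.card = b + 1) :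
    (stairProduct T U).card = T.card * U.card * (a + b).choose a := by
  rw [stairProduct, Finset.card_biUnion, Finset.sum_congr rfl (g := fun _ => (a + b).choose a),
    Finset.sum_const, Finset.card_product, smul_eq_mul]
  · rintro ⟨s, t⟩ hst
    obtain ⟨hs, ht⟩ := Finset.mem_product.1 hst
    have ls : (s.sort (· ≤ ·)).length = a + 1 := by rw [Finset.length_sort, hT s hs]
    have lt : (t.sort (· ≤ ·)).length = b + 1 := by rw [Finset.length_sort, hU t ht]
    have ns : (s.sort (· ≤ ·)).Nodup := Finset.sort_nodup _ _
    have nt : (t.sort (· ≤ ·)).Nodup := Finset.sort_nodup _ _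
    dsimp only
    generalize s.sort (· ≤ ·) = l at ls ns
    generalize t.sort (· ≤ ·) = m at lt nt
    rcases l with _ | ⟨x, l⟩
    · simp at ls
    rcases m with _ | ⟨y, m⟩
    · simp at lt
    rw [card_stair x y l m ns nt]
    simp only [List.length_cons, Nat.add_right_cancel_iff] at ls lt
    rw [ls, lt]
  · rintro ⟨s, t⟩ _ ⟨s', t'⟩ _ hne
    rw [Function.onFun, Finset.disjoint_left]
    intro σ h1 h2
    apply hne
    have h3 := stair_image_fst h1
    have h4 := stair_image_snd h1
    rw [stair_image_fst h2] at h3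
    rw [stair_image_snd h2] at h4
    simp only [Finset.sort_toFinset] at h3 h4
    rw [h3, h4]

variable {E F : Type*} [AddCommGroup E] [Module ℝ E] [AddCommGroup F] [Module ℝ F]
  [Fintype α] [Fintype β]

theorem IsRep.fst {p : α → E} {p' : β → F} {T : Finset (Finset α)} {U : Finset (Finset β)}
    {x : E × F} {w : α × β → ℝ} (h : IsRep (Prod.map p p') (stairProduct T U) x w) :
    IsRep p T x.1 fun a => ∑ b, w (a, b) where
  nonneg a := Finset.sum_nonneg fun b _ => h.nonneg _
  sum_eq := by rw [← h.sum_eq, Fintype.sum_prod_type]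
  supp := by
    obtain ⟨σ, hσ, h0⟩ := h.supp
    obtain ⟨s, hs, t, ht, hst⟩ := mem_stairProduct.1 hσ
    refine ⟨s, hs, fun a ha => Finset.sum_eq_zero fun b _ => h0 _ fun hab => ha ?_⟩
    simpa using fst_mem_of_stair hst hab
  point := by
    rw [← h.point, Prod.fst_sum, Fintype.sum_prod_type]
    simp [Finset.sum_smul]

theorem IsRep.snd {p : α → E} {p' : β → F} {T : Finset (Finset α)} {U : Finset (Finset β)}
    {x : E × F} {w : α × β → ℝ} (h : IsRep (Prod.map p p') (stairProduct T U) x w) :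
    IsRep p' U x.2 fun b => ∑ a, w (a, b) where
  nonneg a := Finset.sum_nonneg fun b _ => h.nonneg _
  sum_eq := by rw [← h.sum_eq, Fintype.sum_prod_type_right]
  supp := by
    obtain ⟨σ, hσ, h0⟩ := h.supp
    obtain ⟨s, hs, t, ht, hst⟩ := mem_stairProduct.1 hσ
    refine ⟨t, ht, fun a ha => Finset.sum_eq_zero fun b _ => h0 _ fun hab => ha ?_⟩
    simpa using snd_mem_of_stair hst hab
  point := by
    rw [← h.point, Prod.snd_sum, Fintype.sum_prod_type_right]
    simp [Finset.sum_smul]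

theorem IsRep.chain {p : α × β → E × F} {T : Finset (Finset α)} {U : Finset (Finset β)}
    {x : E × F} {w : α × β → ℝ} (h : IsRep p (stairProduct T U) x w) (q r : α × β)
    (hq : w q ≠ 0) (hr : w r ≠ 0) : q ≤ r ∨ r ≤ q := by
  obtain ⟨σ, hσ, h0⟩ := h.supp
  obtain ⟨s, hs, t, ht, hst⟩ := mem_stairProduct.1 hσ
  refine chain_of_stair hst (Finset.pairwise_sort _ _) (Finset.pairwise_sort _ _) q ?_ r ?_
  · by_contra hn; exact hq (h0 q hn)
  · by_contra hn; exact hr (h0 r hn)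

/-- Existence is the comonotone coupling of the two given representations. For uniqueness, the
marginals of any representation represent `x` and `y`, hence are forced, and they determine a weight
supported on a chain. -/
theorem existsUnique_isRep_prod {p : α → E} {p' : β → F} {T : Finset (Finset α)}
    {U : Finset (Finset β)} (hT : ∀ s ∈ T, s.Nonempty) (hU : ∀ t ∈ U, t.Nonempty) {x : E} {y : F}
    (hx : ∃! w, IsRep p T x w) (hy : ∃! w, IsRep p' U y w) :
    ∃! w, IsRep (Prod.map p p') (stairProduct T U) (x, y) w := by
  refine existsUnique_of_exists_of_unique ?_ ?_
  · obtain ⟨f, hf, -⟩ := hx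
    obtain ⟨g, hg, -⟩ := hy
    obtain ⟨s, hs, hfs⟩ := hf.supp
    obtain ⟨t, ht, hgt⟩ := hg.supp
    obtain ⟨σ, hσ, w, h0, h1, h2, h3⟩ := exists_stair_coupling (s.sort (· ≤ ·)) (t.sort (· ≤ ·))
      (by
        intro h
        have := congrArg List.length h
        rw [Finset.length_sort] at this
        exact (hT s hs).card_pos.ne' this)
      (by
        intro h
        have := congrArg List.length h
        rw [Finset.length_sort] at this
        exact (hU t ht).card_pos.ne' this)
      f g hf.nonneg hg.nonneg (by simpa using hfs) (by simpa using hgt)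
      (by rw [hf.sum_eq, hg.sum_eq])
    refine ⟨w, h0, ?_, ⟨σ, mem_stairProduct.2 ⟨s, hs, t, ht, hσ⟩, h1⟩, ?_⟩
    · rw [Fintype.sum_prod_type, ← hf.sum_eq]
      exact Finset.sum_congr rfl fun a _ => h2 a
    · ext1
      · rw [Prod.fst_sum, Fintype.sum_prod_type, ← hf.point]
        simp [← Finset.sum_smul, h2]
      · rw [Prod.snd_sum, Fintype.sum_prod_type_right, ← hg.point]
        simp [← Finset.sum_smul, h3]
  · intro w w' hw hw'
    refine eq_of_chain_of_marginals hw.nonneg hw'.nonneg hw.chain hw'.chain ?_ ?_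
    · exact fun a => congrFun (hx.unique hw.fst hw'.fst) a
    · exact fun b => congrFun (hy.unique hw.snd hw'.snd) b

end Product

/-! ### From unique representations to triangulations -/

section Triangulation

variable {V E : Type*} [Fintype V] [AddCommGroup E] [Module ℝ E] {p : V → E}
  {T : Finset (Finset V)} {H : Set E}

theorem sum_smul_mem_convexHull {w : V → ℝ} (h0 : ∀ v, 0 ≤ w v) (h1 : ∑ v, w v = 1) {s : Set V}
    (hs : ∀ v ∉ s, w v = 0) : ∑ v, w v • p v ∈ convexHull ℝ (p '' s) := by
  classical
  have e1 : ∑ v with v ∈ s, w v • p v = ∑ v, w v • p v := by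
    rw [Finset.sum_filter]
    refine Finset.sum_congr rfl fun v _ => ?_
    by_cases h : v ∈ s <;> simp [h, hs]
  have e2 : ∑ v with v ∈ s, w v = 1 := by
    rw [Finset.sum_filter, ← h1]
    refine Finset.sum_congr rfl fun v _ => ?_
    by_cases h : v ∈ s <;> simp [h, hs]
  rw [← e1]
  refine (convex_convexHull ℝ _).sum_mem (fun v _ => h0 v) e2 fun v hv => ?_
  exact subset_convexHull ℝ _ (Set.mem_image_of_mem _ (Finset.mem_filter.1 hv).2)

theorem exists_weight_of_mem_convexHull {x : E} {s : Set V} (hx : x ∈ convexHull ℝ (p '' s)) :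
    ∃ w : V → ℝ, (∀ v, 0 ≤ w v) ∧ ∑ v, w v = 1 ∧ (∀ v ∉ s, w v = 0) ∧ ∑ v, w v • p v = x := by
  classical
  refine convexHull_min (t := {x | ∃ w : V → ℝ, (∀ v, 0 ≤ w v) ∧ ∑ v, w v = 1 ∧
    (∀ v ∉ s, w v = 0) ∧ ∑ v, w v • p v = x}) ?_ ?_ hx
  · rintro _ ⟨v, hv, rfl⟩
    refine ⟨Pi.single v 1, fun u => ?_, by simp, fun u hu => ?_, by simp [Pi.single_apply]⟩
    · have : (0 : V → ℝ) ≤ Pi.single v 1 := Pi.single_nonneg.2 zero_le_one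
      exact this u
    · rw [Pi.single_eq_of_ne]
      rintro rfl; exact hu hv
  · rintro _ ⟨w, h0, h1, h2, rfl⟩ _ ⟨w', h0', h1', h2', rfl⟩ a b ha hb hab
    refine ⟨a • w + b • w', fun v => ?_, ?_, fun v hv => by simp [h2 v hv, h2' v hv], ?_⟩
    · exact add_nonneg (mul_nonneg ha (h0 v)) (mul_nonneg hb (h0' v))
    · simp [Finset.sum_add_distrib, ← Finset.mul_sum, h1, h1', hab]
    · simp [Finset.sum_add_distrib, add_smul, mul_smul, Finset.smul_sum]

/-- Rescaling to total mass one removes the normalization from uniqueness, so that it applies to the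
two signed parts of an affine dependence. -/
theorem eq_of_existsUnique_isRep (hH : Convex ℝ H) (hp : ∀ v, p v ∈ H)
    (hT : ∀ x ∈ H, ∃! w, IsRep p T x w) {w w' : V → ℝ} (h0 : ∀ v, 0 ≤ w v) (h0' : ∀ v, 0 ≤ w' v)
    (hs : ∃ s ∈ T, ∀ v ∉ s, w v = 0) (hs' : ∃ s ∈ T, ∀ v ∉ s, w' v = 0)
    (h1 : ∑ v, w v = ∑ v, w' v) (h2 : ∑ v, w v • p v = ∑ v, w' v • p v) : w = w' := by
  rcases (Finset.sum_nonneg fun v (_ : v ∈ Finset.univ) => h0 v).eq_or_lt with hm | hm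
  · have e := (Finset.sum_eq_zero_iff_of_nonneg fun v _ => h0 v).1 hm.symm
    have e' := (Finset.sum_eq_zero_iff_of_nonneg fun v _ => h0' v).1 (hm.trans h1).symm
    funext v
    rw [e v (Finset.mem_univ v), e' v (Finset.mem_univ v)]
  · set M := ∑ v, w v with hM
    have key : ∀ u : V → ℝ, (∀ v, 0 ≤ u v) → (∃ s ∈ T, ∀ v ∉ s, u v = 0) → ∑ v, u v = M →
        ∑ v, u v • p v = ∑ v, w v • p v → IsRep p T (M⁻¹ • ∑ v, w v • p v) (M⁻¹ • u) := by
      rintro u hu ⟨s, hs, hsu⟩ hu1 hu2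
      refine ⟨fun v => mul_nonneg (inv_nonneg.2 hm.le) (hu v), ?_,
        ⟨s, hs, fun v hv => by simp [hsu v hv]⟩, ?_⟩
      · simp [← Finset.mul_sum, hu1, hm.ne']
      · simp [← hu2, Finset.smul_sum, mul_smul]
    have k1 := key w h0 hs rfl rfl
    have k2 := key w' h0' hs' h1.symm h2.symm
    have hx : (M⁻¹ • ∑ v, w v • p v) ∈ H := by
      rw [← k1.point]
      exact hH.sum_mem (fun v _ => k1.nonneg v) k1.sum_eq fun v _ => hp v
    have := (hT _ hx).unique k1 k2
    exact smul_right_injective _ (inv_ne_zero hm.ne') this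

theorem sum_comp_extend {V F : Type*} [Fintype V] [AddCommMonoid F] {s : Finset V} {u : Finset s}
    {c : s → ℝ} {W : V → ℝ} (h0 : ∀ v ∉ s, W v = 0) (hu : ∀ v : s, v ∉ u → W v = 0)
    (hc : ∀ v ∈ u, W v = c v) (g : V → ℝ → F) (hg : ∀ v, g v 0 = 0) :
    ∑ v, g v (W v) = ∑ v ∈ u, g v (c v) := by
  rw [← Finset.sum_subset (Finset.subset_univ s) (fun v _ hv => by rw [h0 v hv, hg]),
    ← Finset.sum_coe_sort s, ← Finset.sum_subset (Finset.subset_univ u)]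
  · exact Finset.sum_congr rfl fun v hv => by rw [hc v hv]
  · intro v _ hv
    rw [hu v hv, hg]

theorem affineIndependent_of_existsUnique_isRep (hH : Convex ℝ H) (hp : ∀ v, p v ∈ H)
    (hT : ∀ x ∈ H, ∃! w, IsRep p T x w) {s : Finset V} (hs : s ∈ T) :
    AffineIndependent ℝ fun v : s => p v := by
  classical
  rw [affineIndependent_iff]
  intro u c hc hcp
  let W : V → ℝ := fun v => if h : v ∈ s then (if (⟨v, h⟩ : s) ∈ u then c ⟨v, h⟩ else 0) else 0
  have hW0 : ∀ v ∉ s, W v = 0 := fun v hv => by simp [W, hv]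
  have hWc : ∀ v ∈ u, W v = c v := fun v hv => by simp [W, hv]
  have hWu : ∀ v : s, v ∉ u → W v = 0 := fun v hv => by simp [W, hv]
  have hW1 : ∑ v, W v = 0 := (sum_comp_extend hW0 hWu hWc (fun _ r => r) fun _ => rfl).trans hc
  have hWp : ∑ v, W v • p v = 0 := 
    (sum_comp_extend hW0 hWu hWc (fun v r => r • p v) fun v => zero_smul ℝ (p v)).trans hcp
  have hpm : ∀ v, W v = max (W v) 0 - max (-W v) 0 := fun v => by
    rcases le_total (W v) 0 with h | h <;> simp [h]
  -- The positive and negative parts of the dependence live on `s` and have equal mass and equal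
  -- moment, so they coincide and `W` vanishes.
  have heq : (fun v => max (W v) 0) = fun v => max (-W v) 0 := by
    refine eq_of_existsUnique_isRep hH hp hT (fun v => le_max_right _ _)
      (fun v => le_max_right _ _) ⟨s, hs, fun v hv => by simp [hW0 v hv]⟩
      ⟨s, hs, fun v hv => by simp [hW0 v hv]⟩ ?_ ?_
    · rw [← sub_eq_zero, ← Finset.sum_sub_distrib]
      refine Eq.trans ?_ hW1
      exact Finset.sum_congr rfl fun v _ => (hpm v).symm
    · rw [← sub_eq_zero, ← Finset.sum_sub_distrib]
      refine Eq.trans ?_ hWp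
      exact Finset.sum_congr rfl fun v _ => by rw [← sub_smul, ← hpm v]
  intro v hv
  rw [← hWc v hv, hpm v]
  exact sub_eq_zero.2 (congrFun heq v)

/-- The weights of a common point on `s` and on `t` agree, so they are supported on both. -/
theorem convexHull_inter_of_existsUnique_isRep [DecidableEq V] (hH : Convex ℝ H)
    (hp : ∀ v, p v ∈ H) (hT : ∀ x ∈ H, ∃! w, IsRep p T x w) {s t : Finset V} (hs : s ∈ T)
    (ht : t ∈ T) :
    convexHull ℝ (p '' s) ∩ convexHull ℝ (p '' t) = convexHull ℝ (p '' (s ∩ t : Finset V)) := by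
  refine Set.Subset.antisymm ?_ (Set.subset_inter ?_ ?_)
  · rintro x ⟨hxs, hxt⟩
    obtain ⟨w, h0, h1, h2, h3⟩ := exists_weight_of_mem_convexHull hxs
    obtain ⟨w', h0', h1', h2', h3'⟩ := exists_weight_of_mem_convexHull hxt
    have : w = w' := eq_of_existsUnique_isRep hH hp hT h0 h0' ⟨s, hs, h2⟩ ⟨t, ht, h2'⟩
      (h1.trans h1'.symm) (h3.trans h3'.symm)
    subst this
    rw [← h3]
    refine sum_smul_mem_convexHull h0 h1 fun v hv => ?_
    by_cases hvs : v ∈ s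
    · exact h2' v fun h => hv (by simp only [Finset.coe_inter]; exact ⟨hvs, h⟩)
    · exact h2 v hvs
  · exact convexHull_mono (Set.image_mono (by simp))
  · exact convexHull_mono (Set.image_mono (by simp))

end Triangulation

theorem isTriangulation_of_existsUnique_isRep {d : ℕ} {V : Type*} [Fintype V] [DecidableEq V]
    {p : V → Fin d → ℝ} (hinj : Function.Injective p) {T : Finset (Finset V)}
    (hT : ∀ x ∈ convexHull ℝ (Set.range p), ∃! w, IsRep p T x w)
    (hcard : ∀ s ∈ T, s.card = d + 1) :
    IsTriangulation (Set.range p) (T.image fun s => s.map ⟨p, hinj⟩) := by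
  have hH : Convex ℝ (convexHull ℝ (Set.range p)) := convex_convexHull ℝ _
  have hp : ∀ v, p v ∈ convexHull ℝ (Set.range p) := fun v =>
    subset_convexHull ℝ _ (Set.mem_range_self v)
  have hcoe : ∀ s : Finset V, ((s.map ⟨p, hinj⟩ : Finset _) : Set (Fin d → ℝ)) = p '' s := by
    intro s; simp
  have hinter := fun s (hs : s ∈ T) t (ht : t ∈ T) =>
    convexHull_inter_of_existsUnique_isRep hH hp hT hs ht
  refine { vertices_subset := ?_, card_eq := ?_, affineIndependent := ?_, interior_disjoint := ?_,
           union_eq := ?_, inter_common_face := ?_ }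
  · simp only [Finset.mem_image]
    rintro _ ⟨s, hs, rfl⟩
    rw [hcoe]
    exact Set.image_subset_range _ _
  · simp only [Finset.mem_image]
    rintro _ ⟨s, hs, rfl⟩
    rw [Finset.card_map, hcard s hs]
  · simp only [Finset.mem_image]
    rintro _ ⟨s, hs, rfl⟩
    have h := (affineIndependent_of_existsUnique_isRep hH hp hT hs).range
    have e : Set.range (fun v : s => p v) = ((s.map ⟨p, hinj⟩ : Finset _) : Set (Fin d → ℝ)) := by
      rw [hcoe]; ext x; simp
    rw [e] at h
    exact h
  · simp only [Finset.mem_image]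
    rintro _ ⟨s, hs, rfl⟩ _ ⟨t, ht, rfl⟩ hst
    rw [hcoe, hcoe, Set.disjoint_iff_inter_eq_empty, ← interior_inter, hinter s hs t ht,
      ← Set.not_nonempty_iff_eq_empty, interior_convexHull_nonempty_iff_affineSpan_eq_top]
    intro htop
    -- Distinct simplices share at most `d` vertices, too few to span the space affinely, so the
    -- hull of the shared ones has empty interior.
    have hlt : (s ∩ t).card < d + 1 := by
      rw [← hcard s hs]
      refine Finset.card_lt_card (Finset.ssubset_iff_subset_ne.2 ⟨Finset.inter_subset_left, ?_⟩)
      intro h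
      apply hst
      rw [Finset.eq_of_subset_of_card_le (Finset.inter_eq_left.1 h)
        (by rw [hcard s hs, hcard t ht])]
    have hdim := AffineSubspace.vectorSpan_eq_top_of_affineSpan_eq_top ℝ _ _ htop
    have hne : (s ∩ t).Nonempty := by
      by_contra h
      rw [Finset.not_nonempty_iff_eq_empty] at h
      rw [h] at htop
      simp only [Finset.coe_empty, Set.image_empty, AffineSubspace.span_empty] at htop
      exact AffineSubspace.bot_ne_top ℝ _ _ htop
    have hr := finrank_vectorSpan_image_finset_le ℝ p (s ∩ t) (n := (s ∩ t).card - 1)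
      (by have := hne.card_pos; omega)
    rw [Finset.coe_image] at hr
    rw [hdim, finrank_top, Module.finrank_fin_fun] at hr
    have := hne.card_pos
    omega
  · rw [convexHull_eq_self.2 hH |>.symm]
    refine Set.Subset.antisymm ?_ ?_
    · refine Set.iUnion₂_subset fun s hs => ?_
      simp only [Finset.mem_image] at hs
      obtain ⟨s, hs, rfl⟩ := hs
      rw [hcoe, convexHull_eq_self.2 hH]
      exact convexHull_mono (Set.image_subset_range _ _)
    · rw [convexHull_eq_self.2 hH]
      intro x hx
      obtain ⟨w, hw, -⟩ := hT x hx
      obtain ⟨s, hs, h0⟩ := hw.supp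
      refine Set.mem_iUnion₂.2 ⟨_, Finset.mem_image_of_mem _ hs, ?_⟩
      rw [hcoe, ← hw.point]
      exact sum_smul_mem_convexHull hw.nonneg hw.sum_eq h0
  · simp only [Finset.mem_image]
    rintro _ ⟨s, hs, rfl⟩ _ ⟨t, ht, rfl⟩
    refine ⟨(s ∩ t).map ⟨p, hinj⟩, Finset.map_subset_map.2 Finset.inter_subset_left,
      Finset.map_subset_map.2 Finset.inter_subset_right, ?_⟩
    rw [hcoe, hcoe, hcoe, hinter s hs t ht]

/-! ### Face lattices from vertex-facet incidences -/

section FaceLattice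

variable {d : ℕ} {V J : Type*}

/-- The sets of vertices of faces, in terms of an incidence relation between vertices and facets:
the empty set, and the sets containing every vertex that lies on all their common facets. -/
abbrev ClosedVertexSets (R : V → J → Prop) : Type _ :=
  {S : Set V // S.Nonempty → ∀ v, (∀ j, (∀ u ∈ S, R u j) → R v j) → v ∈ S}

/-- In a convex combination that maximizes a functional, only maximizing points carry weight. -/
theorem isExposed_eq_convexHull [Fintype V] {p : V → Fin d → ℝ} {F : Set (Fin d → ℝ)}
    (hF : IsExposed ℝ (convexHull ℝ (Set.range p)) F) :
    F = convexHull ℝ (p '' {v | p v ∈ F}) := by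
  have hconv : Convex ℝ F := hF.convex (convex_convexHull ℝ _)
  refine Set.Subset.antisymm ?_ (convexHull_min (Set.image_subset_iff.2 fun v hv => hv) hconv)
  intro x hx
  obtain ⟨l, hl⟩ := hF ⟨x, hx⟩
  have hxF := hx
  rw [hl] at hx
  obtain ⟨hxP, hmax⟩ := hx
  rw [← Set.image_univ] at hxP
  obtain ⟨w, h0, h1, -, h3⟩ := exists_weight_of_mem_convexHull hxP
  rw [← h3]
  refine sum_smul_mem_convexHull h0 h1 fun v hv => ?_
  have hp : ∀ v, p v ∈ convexHull ℝ (Set.range p) := fun v =>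
    subset_convexHull ℝ _ (Set.mem_range_self v)
  have hsum : ∑ v, w v * (l x - l (p v)) = 0 := by
    have : l x = ∑ v, w v * l (p v) := by
      conv_lhs => rw [← h3]
      simp
    simp only [mul_sub, Finset.sum_sub_distrib, ← Finset.sum_mul, h1, one_mul]
    rw [← this, sub_self]
  have hz := (Finset.sum_eq_zero_iff_of_nonneg fun v _ =>
    mul_nonneg (h0 v) (sub_nonneg.2 (hmax _ (hp v)))).1 hsum v (Finset.mem_univ v)
  rcases mul_eq_zero.1 hz with h | h
  · exact h
  · exfalso
    apply hv
    change p v ∈ F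
    rw [hl]
    exact ⟨hp v, fun y hy => by rw [← sub_eq_zero.1 h]; exact hmax y hy⟩

/-- A polytope with vertices `p` and inequalities `f j x ≤ c j`, with incidence relation `R`. -/
structure HasIncidence (p : V → Fin d → ℝ) (f : J → (Fin d → ℝ) →ₗ[ℝ] ℝ) (c : J → ℝ)
    (R : V → J → Prop) : Prop where
  le : ∀ v j, f j (p v) ≤ c j
  eq_iff : ∀ v j, f j (p v) = c j ↔ R v j
  mem_convexHull : ∀ x, (∀ j, f j x ≤ c j) → x ∈ convexHull ℝ (Set.range p)

variable {p : V → Fin d → ℝ} {f : J → (Fin d → ℝ) →ₗ[ℝ] ℝ} {c : J → ℝ} {R : V → J → Prop}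

theorem HasIncidence.mem_iff (h : HasIncidence p f c R) {x : Fin d → ℝ} :
    x ∈ convexHull ℝ (Set.range p) ↔ ∀ j, f j x ≤ c j := by
  refine ⟨fun hx j => ?_, h.mem_convexHull x⟩
  refine convexHull_min (t := {x | f j x ≤ c j}) ?_ (convex_halfSpace_le (f j).isLinear _) hx
  rintro _ ⟨v, rfl⟩
  exact h.le v j

/-- The vertices of an exposed face form a closed set: perturbing the barycentre of the face
away from a point lying on the same facets stays in the polytope. -/
theorem HasIncidence.mem_of_isExposed [Fintype V] [Fintype J] (h : HasIncidence p f c R) {F : Set (Fin d → ℝ)}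
    (hF : IsExposed ℝ (convexHull ℝ (Set.range p)) F) {S : Set V} (hS : S.Nonempty)
    (hSF : ∀ u ∈ S, p u ∈ F) {y : Fin d → ℝ} (hyP : y ∈ convexHull ℝ (Set.range p))
    (hy : ∀ j, (∀ u ∈ S, R u j) → f j y = c j) : y ∈ F := by
  classical
  obtain ⟨s, rfl⟩ : ∃ s : Finset V, (s : Set V) = S := ⟨S.toFinset, by simp⟩
  simp only [Finset.mem_coe] at hSF hy
  have hs : s.Nonempty := hS
  have hconv : Convex ℝ F := hF.convex (convex_convexHull ℝ _)
  set n : ℝ := (s.card : ℝ) with hn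
  have hn0 : 0 < n := by rw [hn]; exact_mod_cast hs.card_pos
  set x : Fin d → ℝ := ∑ u ∈ s, n⁻¹ • p u with hxdef
  have hxF : x ∈ F := hconv.sum_mem (fun _ _ => inv_nonneg.2 hn0.le)
    (by simp [← hn, hn0.ne']) hSF
  have hfx : ∀ j, c j - f j x = ∑ u ∈ s, n⁻¹ * (c j - f j (p u)) := by
    intro j
    simp [hxdef, mul_sub, Finset.sum_sub_distrib, ← hn, hn0.ne']
  have hle : ∀ j, f j x ≤ c j := h.mem_iff.1 (hF.subset hxF)
  have hlt : ∀ j, f j x = c j → f j y = c j := by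
    intro j hj
    refine hy j fun u hu => (h.eq_iff u j).1 ?_
    have h0 := hfx j
    rw [hj, sub_self] at h0
    have := (Finset.sum_eq_zero_iff_of_nonneg fun u _ => mul_nonneg (inv_nonneg.2 hn0.le)
      (sub_nonneg.2 (h.le u j))).1 h0.symm u hu
    have h2 := (mul_eq_zero.1 this).resolve_left (inv_ne_zero hn0.ne')
    linarith
  -- Inequalities tight at `x` are tight at `y` and stay tight along the line; the others have slack
  -- for small `ε`.
  have hev : ∀ j, ∀ᶠ ε in nhdsWithin (0 : ℝ) (Set.Ioi 0), f j (x + ε • (x - y)) ≤ c j := by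
    intro j
    simp only [map_add, map_smul, map_sub, smul_eq_mul]
    rcases (hle j).eq_or_lt with hj | hj
    · filter_upwards with ε
      rw [hj, hlt j hj]; simp
    · have : Filter.Tendsto (fun ε : ℝ => f j x + ε * (f j x - f j y)) (nhds 0)
          (nhds (f j x + 0 * (f j x - f j y))) := by
        apply Continuous.tendsto' (by fun_prop) _ _ rfl
      rw [zero_mul, add_zero] at this
      exact nhdsWithin_le_nhds ((this.eventually (gt_mem_nhds hj)).mono fun _ h => h.le)
  obtain ⟨ε, hε, hε0⟩ := ((Filter.eventually_all.2 hev).and self_mem_nhdsWithin).exists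
  have hε0 : 0 < ε := hε0
  obtain ⟨l, hl⟩ := hF ⟨x, hxF⟩
  rw [hl] at hxF ⊢
  refine ⟨hyP, fun z hz => (hxF.2 z hz).trans ?_⟩
  have := hxF.2 _ (h.mem_iff.2 hε)
  simp only [map_add, map_smul, map_sub, smul_eq_mul] at this
  have h3 : ε * (l x - l y) ≤ 0 := by linarith
  have := nonpos_of_mul_nonpos_right h3 hε0
  linarith

/-- The sum of the functionals of all facets containing `S` exposes the face: its maximum forces
each of these inequalities to be tight. -/
theorem HasIncidence.exists_face [Fintype J] (h : HasIncidence p f c R) {S : Set V} (hS : S.Nonempty)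
    (hcl : ∀ v, (∀ j, (∀ u ∈ S, R u j) → R v j) → v ∈ S) :
    ∃ F, IsExposed ℝ (convexHull ℝ (Set.range p)) F ∧ {v | p v ∈ F} = S := by
  classical
  set K : Finset J := Finset.univ.filter fun j => ∀ u ∈ S, R u j with hK
  set l : (Fin d → ℝ) →L[ℝ] ℝ := LinearMap.toContinuousLinearMap (∑ j ∈ K, f j) with hl
  have hlx : ∀ x, l x = ∑ j ∈ K, f j x := fun x => by simp [hl]
  have hp : ∀ v, p v ∈ convexHull ℝ (Set.range p) := fun v =>
    subset_convexHull ℝ _ (Set.mem_range_self v)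
  have hmax : ∀ x ∈ convexHull ℝ (Set.range p), l x ≤ ∑ j ∈ K, c j := fun x hx => by
    rw [hlx]; exact Finset.sum_le_sum fun j _ => h.mem_iff.1 hx j
  have hSl : ∀ u ∈ S, l (p u) = ∑ j ∈ K, c j := fun u hu => by
    rw [hlx]
    exact Finset.sum_congr rfl fun j hj => (h.eq_iff u j).2 ((Finset.mem_filter.1 hj).2 u hu)
  refine ⟨{x ∈ convexHull ℝ (Set.range p) | ∀ y ∈ convexHull ℝ (Set.range p), l y ≤ l x},
    fun _ => ⟨l, rfl⟩, ?_⟩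
  ext v
  constructor
  · rintro ⟨-, hv⟩
    obtain ⟨u, hu⟩ := hS
    have h1 := hv _ (hp u)
    rw [hSl u hu] at h1
    have h2 : ∑ j ∈ K, (c j - f j (p v)) = 0 := by
      rw [Finset.sum_sub_distrib, ← hlx, le_antisymm (hmax _ (hp v)) h1, sub_self]
    refine hcl v fun j hj => (h.eq_iff v j).1 ?_
    have := (Finset.sum_eq_zero_iff_of_nonneg fun j _ => sub_nonneg.2 (h.le v j)).1 h2 j
      (Finset.mem_filter.2 ⟨Finset.mem_univ j, hj⟩)
    linarith
  · intro hv
    exact ⟨hp v, fun y hy => by rw [hSl v hv]; exact hmax y hy⟩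

/-- The face lattice of a polytope is determined by its vertex-facet incidences. -/
theorem HasIncidence.nonempty_orderIso [Fintype V] [Fintype J] (h : HasIncidence p f c R) :
    Nonempty (FaceLattice (convexHull ℝ (Set.range p)) ≃o ClosedVertexSets R) := by
  have hp : ∀ v, p v ∈ convexHull ℝ (Set.range p) := fun v =>
    subset_convexHull ℝ _ (Set.mem_range_self v)
  let φ : FaceLattice (convexHull ℝ (Set.range p)) ↪o ClosedVertexSets R :=
    OrderEmbedding.ofMapLEIff (fun F => ⟨{v | p v ∈ F.1}, fun hne v hv =>
      h.mem_of_isExposed F.2 hne (fun _ hu => hu) (hp v) fun j hj => (h.eq_iff v j).2 (hv j hj)⟩)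
      (by
        rintro ⟨F, hF⟩ ⟨G, hG⟩
        constructor
        · intro hFG
          change F ⊆ G
          rw [isExposed_eq_convexHull hF, isExposed_eq_convexHull hG]
          exact convexHull_mono (Set.image_mono hFG)
        · exact fun hFG v hv => hFG hv)
  refine ⟨RelIso.ofSurjective φ ?_⟩
  rintro ⟨S, hS⟩
  rcases S.eq_empty_or_nonempty with rfl | hne
  · exact ⟨⟨∅, isExposed_empty⟩, Subtype.ext (by ext; simp [φ])⟩
  · obtain ⟨F, hF, hFS⟩ := h.exists_face hne (hS hne)
    exact ⟨⟨F, hF⟩, Subtype.ext hFS⟩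

end FaceLattice

/-! ### Boundedness of the triangulation sizes -/

/-- Hahn–Banach separates `x` from the hull of the other generators, and every point of `P` lies on
a segment from `x` to that hull. This embeds the vertices into the face lattice. -/
theorem IsPolytope.extremePoints_singleton_isExposed {d : ℕ} {P : Set (Fin d → ℝ)}
    (hP : IsPolytope P) {x : Fin d → ℝ} (hx : x ∈ P.extremePoints ℝ) : IsExposed ℝ P {x} := by
  obtain ⟨V, hV, rfl⟩ := hP
  have hxV : x ∈ V := extremePoints_convexHull_subset hx
  have hcompact : IsCompact (convexHull ℝ (V \ {x})) := 
    (hV.subset Set.sdiff_subset).isCompact_convexHull ℝ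
  have hnot : x ∉ convexHull ℝ (V \ {x}) := by
    have h1 := (convex_convexHull ℝ V).mem_extremePoints_iff_convex_sdiff.1 hx
    intro hmem
    have : convexHull ℝ (V \ {x}) ⊆ convexHull ℝ V \ {x} :=
      convexHull_min (Set.sdiff_subset_sdiff_left (subset_convexHull ℝ V)) h1.2
    exact (this hmem).2 rfl
  obtain ⟨l, u, hlu, hux⟩ := geometric_hahn_banach_closed_point (convex_convexHull ℝ _)
    hcompact.isClosed hnot
  have hseg : ∀ y ∈ convexHull ℝ V, y = x ∨ l y < l x := by
    intro y hy
    have hVe : V = insert x (V \ {x}) := by simp [hxV]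
    rcases (V \ {x}).eq_empty_or_nonempty with he | hne
    · rw [hVe, he] at hy
      left; simpa using hy
    · rw [hVe, convexHull_insert hne] at hy
      rw [mem_convexJoin] at hy
      obtain ⟨a, ha, b, hb, hy⟩ := hy
      rw [Set.mem_singleton_iff] at ha
      subst ha
      obtain ⟨s, t, hs, ht, hst, rfl⟩ := hy
      rcases ht.eq_or_lt with rfl | ht'
      · left; simp at hst; simp [hst]
      · right
        have h1 := hlu b hb
        have hs' : s = 1 - t := by linarith
        simp only [map_add, map_smul, smul_eq_mul, hs']
        nlinarith
  intro _
  refine ⟨l, Set.Subset.antisymm ?_ ?_⟩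
  · rintro _ rfl
    refine ⟨hx.1, fun y hy => ?_⟩
    rcases hseg y hy with rfl | h
    · exact le_rfl
    · exact h.le
  · rintro y ⟨hy, hmax⟩
    rcases hseg y hy with h | h
    · exact h
    · exact absurd (hmax x hx.1) (not_le.2 h)

theorem IsPolytope.finite_faceLattice {d : ℕ} {P : Set (Fin d → ℝ)} (hP : IsPolytope P) :
    Finite (FaceLattice P) := by
  obtain ⟨V, hV, rfl⟩ := hP
  have := hV.fintype
  have hr : V = Set.range (Subtype.val : V → Fin d → ℝ) := by simp
  have hr' : convexHull ℝ V = convexHull ℝ (Set.range (Subtype.val : V → Fin d → ℝ)) :=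
    congrArg _ hr
  refine Finite.of_injective (β := Set V) (fun F => {v | (v : Fin d → ℝ) ∈ F.1}) ?_
  rintro ⟨F, hF⟩ ⟨G, hG⟩ hFG
  rw [hr'] at hF hG
  refine Subtype.ext ?_
  change F = G
  rw [isExposed_eq_convexHull hF, isExposed_eq_convexHull hG]
  exact congrArg (fun S => convexHull ℝ (Subtype.val '' S)) hFG

theorem unitCube_eq_convexHull (d : ℕ) : unitCube d =
    convexHull ℝ (Set.range fun (v : Fin d → Bool) i => if v i then (1 : ℝ) else 0) := by
  have h1 : unitCube d = Set.univ.pi fun _ => convexHull ℝ ({0, 1} : Set ℝ) := by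
    ext x
    simp [unitCube, convexHull_pair, segment_eq_Icc, Pi.le_def]
  rw [h1, ← convexHull_pi]
  congr 1
  ext x
  constructor
  · intro hx
    refine ⟨fun i => decide (x i = 1), funext fun i => ?_⟩
    have : x i = 0 ∨ x i = 1 := by simpa using hx i trivial
    rcases this with h | h <;> simp [h]
  · rintro ⟨v, rfl⟩ i _
    by_cases h : v i <;> simp [h]

theorem isPolytope_unitCube (d : ℕ) : IsPolytope (unitCube d) :=
  ⟨_, Set.finite_range _, unitCube_eq_convexHull d⟩

/-- Needed because `sSup` on `ℕ` is a maximum only for bounded nonempty sets. Vertices inject into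
the finite face lattice of the unit cube, and a triangulation is a family of vertex sets. -/
theorem bddAbove_cubeTriangulationSizes (d : ℕ) : BddAbove (cubeTriangulationSizes d) := by
  classical
  have hfin := (isPolytope_unitCube d).finite_faceLattice
  refine ⟨2 ^ Nat.card (FaceLattice (unitCube d)), ?_⟩
  rintro _ ⟨C, ⟨hP, ⟨e⟩⟩, T, hT, rfl⟩
  let φ : C.extremePoints ℝ → FaceLattice (unitCube d) := fun x =>
    e ⟨{x.1}, hP.extremePoints_singleton_isExposed x.2⟩
  have hφ : Function.Injective φ := by
    intro x y hxy
    have := congrArg Subtype.val (e.injective hxy)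
    exact Subtype.ext (Set.singleton_injective this)
  have hfx : (C.extremePoints ℝ).Finite := Set.finite_coe_iff.1 (Finite.of_injective φ hφ)
  have hsub : T ⊆ hfx.toFinset.powerset := by
    intro s hs
    rw [Finset.mem_powerset]
    intro x hx
    rw [Set.Finite.mem_toFinset]
    exact hT.vertices_subset s hs hx
  refine (Finset.card_le_card hsub).trans ?_
  rw [Finset.card_powerset]
  refine Nat.pow_le_pow_right two_pos ?_
  rw [← Set.ncard_eq_toFinset_card _ hfx, ← Nat.card_coe_set_eq]
  exact Nat.card_le_card_of_injective φ hφ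

/-! ### Recognizing combinatorial cubes -/

/-- The standard vertex-facet incidences of the cube. -/
theorem hasIncidence_unitCube (d : ℕ) :
    HasIncidence (fun (v : Fin d → Bool) i => if v i then (1 : ℝ) else 0)
      (fun j : Fin d × Bool => (if j.2 then (1 : ℝ) else -1) • LinearMap.proj j.1)
      (fun j => if j.2 then 1 else 0) (fun v j => v j.1 = j.2) where
  le := by
    rintro v ⟨i, _ | _⟩ <;> cases h : v i <;> simp [h]
  eq_iff := by
    rintro v ⟨i, _ | _⟩ <;> cases h : v i <;> simp [h]
  mem_convexHull := by
    intro x hx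
    rw [← unitCube_eq_convexHull]
    refine ⟨fun i => ?_, fun i => ?_⟩
    · simpa using hx (i, false)
    · simpa using hx (i, true)

theorem HasIncidence.isCombinatorialCube {d : ℕ} {p : (Fin d → Bool) → Fin d → ℝ}
    {f : Fin d × Bool → (Fin d → ℝ) →ₗ[ℝ] ℝ} {c : Fin d × Bool → ℝ}
    (h : HasIncidence p f c fun v j => v j.1 = j.2) :
    IsCombinatorialCube d (convexHull ℝ (Set.range p)) := by
  refine ⟨⟨_, Set.finite_range p, rfl⟩, ?_⟩
  obtain ⟨e⟩ := h.nonempty_orderIso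
  obtain ⟨e'⟩ := (hasIncidence_unitCube d).nonempty_orderIso
  rw [unitCube_eq_convexHull]
  exact ⟨e.trans e'.symm⟩

theorem HasIncidence.injective {d : ℕ} {p : (Fin d → Bool) → Fin d → ℝ}
    {f : Fin d × Bool → (Fin d → ℝ) →ₗ[ℝ] ℝ} {c : Fin d × Bool → ℝ}
    (h : HasIncidence p f c fun v j => v j.1 = j.2) : Function.Injective p := by
  intro u v huv
  funext i
  rw [← h.eq_iff u (i, v i), huv]
  exact (h.eq_iff v (i, v i)).2 rfl

/-- A cube vertex is determined by the facets through it, so each singleton is a closed vertex set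
and hence a face. -/
theorem HasIncidence.extremePoints {d : ℕ} {p : (Fin d → Bool) → Fin d → ℝ}
    {f : Fin d × Bool → (Fin d → ℝ) →ₗ[ℝ] ℝ} {c : Fin d × Bool → ℝ}
    (h : HasIncidence p f c fun v j => v j.1 = j.2) :
    (convexHull ℝ (Set.range p)).extremePoints ℝ = Set.range p := by
  refine Set.Subset.antisymm extremePoints_convexHull_subset ?_
  rintro _ ⟨v, rfl⟩
  obtain ⟨F, hF, hFv⟩ := h.exists_face (S := {v}) (Set.singleton_nonempty v) (by
    intro u hu
    rw [Set.mem_singleton_iff]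
    funext i
    exact hu (i, v i) (by rintro _ rfl; rfl))
  have hFe := isExposed_eq_convexHull hF
  rw [hFv, Set.image_singleton, convexHull_singleton] at hFe
  rw [hFe] at hF
  exact isExtreme_singleton.1 hF.isExtreme

/-! ### Products of triangulated cubes -/

theorem isRep_map_iff {V V' E E' : Type*} [Fintype V] [Fintype V'] [AddCommGroup E] [Module ℝ E]
    [AddCommGroup E'] [Module ℝ E'] (e : V ≃ V') (L : E ≃ₗ[ℝ] E') {p : V → E}
    {T : Finset (Finset V)} {x : E} {w : V' → ℝ} :
    IsRep (fun v => L (p (e.symm v))) (T.map e.finsetCongr.toEmbedding) (L x) w ↔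
      IsRep p T x (w ∘ e) := by
  have h1 : ∑ v, w (e v) = ∑ v, w v := e.sum_comp w
  have h2 : ∑ v, w v • L (p (e.symm v)) = L (∑ v, w (e v) • p v) := by
    rw [← e.sum_comp]
    simp
  have h3 : (∃ s ∈ T.map e.finsetCongr.toEmbedding, ∀ v ∉ s, w v = 0) ↔
      ∃ s ∈ T, ∀ v ∉ s, w (e v) = 0 := by
    simp only [Finset.mem_map, Equiv.coe_toEmbedding, exists_exists_and_eq_and]
    refine exists_congr fun s => and_congr_right fun _ => ?_
    rw [← e.forall_congr_right (q := fun v => v ∉ e.finsetCongr s → w v = 0)]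
    simp
  constructor
  · intro h
    exact ⟨fun v => h.nonneg _, h1.trans h.sum_eq, h3.1 h.supp, L.injective (h2 ▸ h.point)⟩
  · intro h
    exact ⟨fun v => by simpa using h.nonneg (e.symm v), h1 ▸ h.sum_eq, h3.2 h.supp,
      by rw [h2]; exact congrArg L h.point⟩

theorem existsUnique_isRep_map {V V' E E' : Type*} [Fintype V] [Fintype V'] [AddCommGroup E]
    [Module ℝ E] [AddCommGroup E'] [Module ℝ E'] (e : V ≃ V') (L : E ≃ₗ[ℝ] E') {p : V → E}
    {T : Finset (Finset V)} {x : E} (h : ∃! w, IsRep p T x w) :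
    ∃! w, IsRep (fun v => L (p (e.symm v))) (T.map e.finsetCongr.toEmbedding) (L x) w := by
  obtain ⟨w, hw, hu⟩ := h
  refine ⟨w ∘ e.symm, (isRep_map_iff e L).2 (by simpa [Function.comp_assoc] using hw), ?_⟩
  intro w' hw'
  rw [← hu _ ((isRep_map_iff e L).1 hw')]
  simp [Function.comp_assoc]

/-- Any linear orders on the two vertex sets will do; they are chosen here and disappear from the
statement. -/
theorem exists_product_triangulation {α β E F : Type*} [Fintype α] [Fintype β] [AddCommGroup E]
    [Module ℝ E] [AddCommGroup F] [Module ℝ F] (p : α → E) (p' : β → F) {T : Finset (Finset α)}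
    {U : Finset (Finset β)} {a b : ℕ} (hT : ∀ s ∈ T, s.card = a + 1)
    (hU : ∀ t ∈ U, t.card = b + 1) :
    ∃ P : Finset (Finset (α × β)), (∀ σ ∈ P, σ.card = a + b + 1) ∧
      P.card = T.card * U.card * (a + b).choose a ∧
      ∀ x y, (∃! w, IsRep p T x w) → (∃! w, IsRep p' U y w) →
        ∃! w, IsRep (Prod.map p p') P (x, y) w := by
  let _ : LinearOrder α := LinearOrder.lift' (Fintype.equivFin α) (Equiv.injective _)
  let _ : LinearOrder β := LinearOrder.lift' (Fintype.equivFin β) (Equiv.injective _)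
  refine ⟨stairProduct T U, fun σ h => card_of_mem_stairProduct hT hU h, card_stairProduct hT hU,
    fun x y => existsUnique_isRep_prod (fun s hs => ?_) (fun t ht => ?_)⟩
  · exact Finset.card_pos.1 (by rw [hT s hs]; omega)
  · exact Finset.card_pos.1 (by rw [hU t ht]; omega)

/-- There is a combinatorial `d`-cube, given by its vertices and its facet inequalities, with a
triangulation of size `n`. -/
def HasCubeTriangulation (d n : ℕ) : Prop :=
  ∃ (p : (Fin d → Bool) → Fin d → ℝ) (f : Fin d × Bool → (Fin d → ℝ) →ₗ[ℝ] ℝ)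
    (c : Fin d × Bool → ℝ) (T : Finset (Finset (Fin d → Bool))),
    (∀ v j, f j (p v) ≤ c j) ∧ (∀ v j, f j (p v) = c j ↔ v j.1 = j.2) ∧
    (∀ x, (∀ j, f j x ≤ c j) → ∃! w, IsRep p T x w) ∧ (∀ s ∈ T, s.card = d + 1) ∧ T.card = n

theorem HasCubeTriangulation.mem {d n : ℕ} (h : HasCubeTriangulation d n) :
    n ∈ cubeTriangulationSizes d := by
  classical
  obtain ⟨p, f, c, T, hle, heq, hT, hcard, rfl⟩ := h
  -- Existence of representations already shows that the inequalities cut out no more than the hull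
  -- of the vertices.
  have hI : HasIncidence p f c fun v j => v j.1 = j.2 := ⟨hle, heq, fun x hx => by
    obtain ⟨w, hw, -⟩ := hT x hx
    rw [← hw.point, ← Set.image_univ]
    exact sum_smul_mem_convexHull hw.nonneg hw.sum_eq (by simp)⟩
  refine ⟨_, hI.isCombinatorialCube, T.image fun s => s.map ⟨p, hI.injective⟩, ?_, ?_⟩
  · rw [hI.extremePoints]
    exact isTriangulation_of_existsUnique_isRep hI.injective
      (fun x hx => hT x (hI.mem_iff.1 hx)) hcard
  · exact Finset.card_image_of_injective _ (Finset.map_injective _)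

/-- Concatenation of vectors, as a linear equivalence. -/
def appendLinearEquiv (a b : ℕ) : ((Fin a → ℝ) × (Fin b → ℝ)) ≃ₗ[ℝ] (Fin (a + b) → ℝ) where
  __ := Fin.appendEquiv a b
  map_add' x y := by
    funext i
    refine Fin.addCases (fun i => ?_) (fun i => ?_) i <;> simp [Fin.appendEquiv]
  map_smul' r x := by
    funext i
    refine Fin.addCases (fun i => ?_) (fun i => ?_) i <;> simp [Fin.appendEquiv]

/-- Facets of a product come from facets of either factor, so cube incidences concatenate. Dividing
the size by `(a + b)!` gives `(n / a!) * (m / b!)`. -/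
theorem HasCubeTriangulation.prod {a b n m : ℕ} (h : HasCubeTriangulation a n)
    (h' : HasCubeTriangulation b m) :
    HasCubeTriangulation (a + b) (n * m * (a + b).choose a) := by
  obtain ⟨p, f, c, T, hle, heq, hT, hcard, rfl⟩ := h
  obtain ⟨p', f', c', T', hle', heq', hT', hcard', rfl⟩ := h'
  obtain ⟨P, hPc, hPn, hP⟩ := exists_product_triangulation p p' hcard hcard'
  let e := Fin.appendEquiv (α := Bool) a b
  let L := appendLinearEquiv a b
  have hL : ∀ y, L.symm (L y) = y := L.symm_apply_apply
  let g : Fin (a + b) × Bool → (Fin (a + b) → ℝ) →ₗ[ℝ] ℝ := fun j =>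
    Fin.addCases (motive := fun _ => (Fin (a + b) → ℝ) →ₗ[ℝ] ℝ)
      (fun i => (f (i, j.2) ∘ₗ LinearMap.fst ℝ _ _) ∘ₗ L.symm.toLinearMap)
      (fun i => (f' (i, j.2) ∘ₗ LinearMap.snd ℝ _ _) ∘ₗ L.symm.toLinearMap) j.1
  let k : Fin (a + b) × Bool → ℝ := fun j =>
    Fin.addCases (motive := fun _ => ℝ) (fun i => c (i, j.2)) (fun i => c' (i, j.2)) j.1
  have gl : ∀ i t x, g (Fin.castAdd b i, t) (L x) = f (i, t) x.1 := by
    intro i t x; simp [g, hL]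
  have gr : ∀ i t x, g (Fin.natAdd a i, t) (L x) = f' (i, t) x.2 := by
    intro i t x; simp [g, hL]
  have kl : ∀ i t, k (Fin.castAdd b i, t) = c (i, t) := by intro i t; simp [k]
  have kr : ∀ i t, k (Fin.natAdd a i, t) = c' (i, t) := by intro i t; simp [k]
  refine ⟨fun v => L (Prod.map p p' (e.symm v)), g, k, P.map e.finsetCongr.toEmbedding,
    ?_, ?_, ?_, ?_, ?_⟩
  · rintro v ⟨i, t⟩
    refine Fin.addCases (fun i => ?_) (fun i => ?_) i
    · rw [gl, kl]; exact hle _ _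
    · rw [gr, kr]; exact hle' _ _
  · rintro v ⟨i, t⟩
    refine Fin.addCases (fun i => ?_) (fun i => ?_) i
    · rw [gl, kl]; exact heq _ _
    · rw [gr, kr]; exact heq' _ _
  · intro x hx
    obtain ⟨y, rfl⟩ := L.surjective x
    refine existsUnique_isRep_map e L (hP y.1 y.2 (hT _ ?_) (hT' _ ?_))
    · rintro ⟨i, t⟩
      rw [← gl, ← kl]; exact hx _
    · rintro ⟨i, t⟩
      rw [← gr, ← kr]; exact hx _
  · intro s hs
    obtain ⟨s, hs', rfl⟩ := Finset.mem_map.1 hs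
    simp [hPc s hs']
  · rw [Finset.card_map, hPn]

/-! ### The building blocks: point, segment and trapezoid prism -/

theorem hasCubeTriangulation_zero : HasCubeTriangulation 0 1 := by
  refine ⟨0, 0, 0, {Finset.univ}, by simp, fun v j => j.1.elim0, fun x _ => ?_, by simp, by simp⟩
  refine ⟨1, ⟨by simp, by simp, ⟨Finset.univ, Finset.mem_singleton_self _,
    fun v hv => absurd (Finset.mem_univ v) hv⟩, Subsingleton.elim _ _⟩, ?_⟩
  intro w hw
  funext v
  have := hw.sum_eq
  rw [Fintype.sum_subsingleton _ v] at this
  simpa using this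

theorem hasCubeTriangulation_one : HasCubeTriangulation 1 1 := by
  have hs : ∀ g : (Fin 1 → Bool) → ℝ, ∑ v, g v = g (fun _ => false) + g fun _ => true := by
    intro g
    have hu : (Finset.univ : Finset (Fin 1 → Bool)) = {fun _ => false, fun _ => true} := by decide
    rw [hu, Finset.sum_pair (by decide)]
  refine ⟨fun v i => if v i then 1 else 0,
    fun j => (if j.2 then (1 : ℝ) else -1) • LinearMap.proj j.1, fun j => if j.2 then 1 else 0,
    {Finset.univ}, (hasIncidence_unitCube 1).le, (hasIncidence_unitCube 1).eq_iff, fun x hx => ?_,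
    by simp, by simp⟩
  have h0 : 0 ≤ x 0 := by simpa using hx (0, false)
  have h1 : x 0 ≤ 1 := by simpa using hx (0, true)
  refine ⟨fun v => if v 0 then x 0 else 1 - x 0, ⟨fun v => ?_, ?_, ⟨Finset.univ, by simp, by simp⟩,
    ?_⟩, ?_⟩
  · split_ifs <;> linarith
  · simp [hs]
  · funext i
    rw [Subsingleton.elim i 0]
    simp [hs]
  · intro w hw
    have e1 := hw.sum_eq
    have e2 := congrFun hw.point 0
    simp [hs] at e1 e2
    have hv : ∀ v : Fin 1 → Bool, v = (fun _ => false) ∨ v = fun _ => true := by decide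
    funext v
    rcases hv v with rfl | rfl
    · simp; linarith
    · simpa using e2

/-- The coordinates of the vertices of the product of a trapezoid with an interval. -/
def trapezoidPrismCoord : Fin 8 → Fin 3 → ℤ :=
  ![![0, 0, 0], ![0, 1, 0], ![0, 0, 1], ![0, 2, 1], ![1, 0, 0], ![1, 1, 0], ![1, 0, 1], ![1, 2, 1]]

/-- The vertices of the product of a trapezoid with an interval. -/
def trapezoidPrism (v : Fin 8) (i : Fin 3) : ℝ :=
  trapezoidPrismCoord v i

/-- A triangulation of the trapezoid prism with seven tetrahedra. -/
def sevenTetrahedra : Finset (Finset (Fin 8)) :=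
  {{0, 1, 2, 4}, {1, 2, 3, 6}, {1, 2, 4, 6}, {1, 3, 4, 6}, {1, 3, 4, 7}, {1, 4, 5, 7}, {3, 4, 6, 7}}

theorem sum_trapezoidPrism {w : Fin 8 → ℝ} {x : Fin 3 → ℝ} :
    ∑ v, w v • trapezoidPrism v = x ↔
      w 4 + w 5 + w 6 + w 7 = x 0 ∧ w 1 + 2 * w 3 + w 5 + 2 * w 7 = x 1 ∧
        w 2 + w 3 + w 6 + w 7 = x 2 := by
  simp only [funext_iff, Fin.forall_fin_succ, Fin.sum_univ_eight, Pi.add_apply, Pi.smul_apply,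
    trapezoidPrism, trapezoidPrismCoord]
  simp
  intros
  constructor <;> intro h <;> linarith

/-- The height function inducing the regular triangulation `sevenTetrahedra`: weights supported
on one of the tetrahedra are the unique minimizers of the total height. -/
theorem height_le_of_mem_sevenTetrahedra {s : Finset (Fin 8)} (hs : s ∈ sevenTetrahedra)
    {w u : Fin 8 → ℝ} (hw : ∀ v ∉ s, w v = 0) (hu : ∀ v, 0 ≤ u v) (h1 : ∑ v, w v = ∑ v, u v)
    (h2 : ∑ v, w v • trapezoidPrism v = ∑ v, u v • trapezoidPrism v) :
    5 * w 0 + w 2 + w 4 + 8 * w 5 + w 6 + 4 * w 7 ≤ 5 * u 0 + u 2 + u 4 + 8 * u 5 + u 6 + 4 * u 7 ∧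
      (5 * u 0 + u 2 + u 4 + 8 * u 5 + u 6 + 4 * u 7 ≤
        5 * w 0 + w 2 + w 4 + 8 * w 5 + w 6 + 4 * w 7 → u = w) := by
  obtain ⟨e0, e1, e2⟩ := sum_trapezoidPrism.1 h2
  obtain ⟨f0, f1, f2⟩ := sum_trapezoidPrism.1 (Eq.refl (∑ v, u v • trapezoidPrism v))
  rw [← f0] at e0
  rw [← f1] at e1
  rw [← f2] at e2
  clear f0 f1 f2 h2
  simp only [Fin.sum_univ_eight] at h1
  have w0 := hw 0
  have w1 := hw 1
  have w2 := hw 2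
  have w3 := hw 3
  have w4 := hw 4
  have w5 := hw 5
  have w6 := hw 6
  have w7 := hw 7
  have u0 := hu 0
  have u1 := hu 1
  have u2 := hu 2
  have u3 := hu 3
  have u4 := hu 4
  have u5 := hu 5
  have u6 := hu 6
  have u7 := hu 7
  clear hw hu
  simp only [sevenTetrahedra, Finset.mem_insert, Finset.mem_singleton] at hs
  -- For each tetrahedron the height gap is a combination of the `u v` with `v ∉ s`, with strictly
  -- positive coefficients; no sign of `w` is needed.
  rcases hs with rfl | rfl | rfl | rfl | rfl | rfl | rfl <;> simp at w0 w1 w2 w3 w4 w5 w6 w7 <;>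
    refine ⟨by linarith, fun h => ?_⟩ <;> funext v <;> fin_cases v <;>
    simp only [Fin.zero_eta, Fin.mk_one, Fin.reduceFinMk] <;> linarith

theorem existsUnique_isRep_sevenTetrahedra {x : Fin 3 → ℝ} (h0 : 0 ≤ x 0) (h0' : x 0 ≤ 1)
    (h1 : 0 ≤ x 1) (h1' : x 1 - x 2 ≤ 1) (h2 : 0 ≤ x 2) (h2' : x 2 ≤ 1) :
    ∃! w, IsRep trapezoidPrism sevenTetrahedra x w := by
  refine existsUnique_of_exists_of_unique ?_ ?_
  · have key : ∀ a b c d e f g h : ℝ,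
        (∃ s ∈ sevenTetrahedra, ∀ v ∉ s, ![a, b, c, d, e, f, g, h] v = 0) →
        0 ≤ a → 0 ≤ b → 0 ≤ c → 0 ≤ d → 0 ≤ e → 0 ≤ f → 0 ≤ g → 0 ≤ h →
        a + b + c + d + e + f + g + h = 1 → e + f + g + h = x 0 → b + 2 * d + f + 2 * h = x 1 →
        c + d + g + h = x 2 → ∃ w, IsRep trapezoidPrism sevenTetrahedra x w := by
      intro a b c d e f g h hs ha hb hc hd he hf hg hh e0 e1 e2 e3
      refine ⟨![a, b, c, d, e, f, g, h], fun v => ?_, ?_, hs, sum_trapezoidPrism.2 ⟨e1, e2, e3⟩⟩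
      · fin_cases v <;> assumption
      · rw [Fin.sum_univ_eight]; exact e0
    generalize x 0 = X, x 1 = Y, x 2 = Z at *
    have supp : ∀ s ∈ sevenTetrahedra, ∀ w : Fin 8 → ℝ, (∀ v, v ∈ s ∨ w v = 0) →
        ∃ s ∈ sevenTetrahedra, ∀ v ∉ s, w v = 0 := fun s hs w h =>
      ⟨s, hs, fun v hv => (h v).resolve_left hv⟩
    -- A decision tree along the planes of interior walls; each leaf supplies explicit barycentric
    -- coordinates. `T1` and `T6` are isolated because each is reached from two leaves.
    rcases le_total (X + Y + Z) 1 with a1 | a1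
    · refine key (1 - X - Y - Z) Y Z 0 X 0 0 0 (supp {0, 1, 2, 4} (by decide) _ ?_)
        ?_ ?_ ?_ ?_ ?_ ?_ ?_ ?_ ?_ ?_ ?_ ?_ <;>
        first | linarith | (intro v; fin_cases v <;> simp)
    have T1 : 2 * X + Y ≤ 1 + Z → 1 ≤ Y + Z → ∃ w, IsRep trapezoidPrism sevenTetrahedra x w := by
      intro a2 a3
      refine key 0 (1 - Z) ((1 - 2 * X - Y + Z) / 2) ((Y + Z - 1) / 2) 0 0 X 0
        (supp {1, 2, 3, 6} (by decide) _ ?_) ?_ ?_ ?_ ?_ ?_ ?_ ?_ ?_ ?_ ?_ ?_ ?_ <;>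
        first | linarith | (intro v; fin_cases v <;> simp)
    have T6 : 2 ≤ 2 * X + Y → Y ≤ 2 * Z → ∃ w, IsRep trapezoidPrism sevenTetrahedra x w := by
      intro a2 a3
      refine key 0 0 0 (1 - X) (1 - Z) 0 (Z - Y / 2) (X + Y / 2 - 1)
        (supp {3, 4, 6, 7} (by decide) _ ?_) ?_ ?_ ?_ ?_ ?_ ?_ ?_ ?_ ?_ ?_ ?_ ?_ <;>
        first | linarith | (intro v; fin_cases v <;> simp)
    rcases le_total (X + Y) 1 with a2 | a2
    · rcases le_total (Y + Z) 1 with a3 | a3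
      · refine key 0 Y (1 - X - Y) 0 (1 - Y - Z) 0 (X + Y + Z - 1) 0
          (supp {1, 2, 4, 6} (by decide) _ ?_) ?_ ?_ ?_ ?_ ?_ ?_ ?_ ?_ ?_ ?_ ?_ ?_ <;>
          first | linarith | (intro v; fin_cases v <;> simp)
      · exact T1 (by linarith) a3
    rcases le_total (2 * X + Y) (1 + Z) with a3 | a3
    · exact T1 a3 (by linarith)
    rcases le_total (X + Y) (1 + Z) with a4 | a4
    · rcases le_total (2 * X + Y) 2 with a5 | a5
      · refine key 0 (2 - 2 * X - Y) 0 (X + Y - 1) (2 * X + Y - Z - 1) 0 (1 - X - Y + Z) 0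
          (supp {1, 3, 4, 6} (by decide) _ ?_) ?_ ?_ ?_ ?_ ?_ ?_ ?_ ?_ ?_ ?_ ?_ ?_ <;>
          first | linarith | (intro v; fin_cases v <;> simp)
      · exact T6 a5 (by linarith)
    rcases le_total Y (2 * Z) with a5 | a5
    · exact T6 (by linarith) a5
    rcases le_total (X + Y) (1 + 2 * Z) with a6 | a6
    · refine key 0 (Y - 2 * Z) 0 (1 - X - Y + 2 * Z) (1 - Y + Z) 0 0 (X + Y - Z - 1)
        (supp {1, 3, 4, 7} (by decide) _ ?_) ?_ ?_ ?_ ?_ ?_ ?_ ?_ ?_ ?_ ?_ ?_ ?_ <;>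
        first | linarith | (intro v; fin_cases v <;> simp)
    · refine key 0 (1 - X) 0 0 (1 - Y + Z) (X + Y - 2 * Z - 1) 0 Z
        (supp {1, 4, 5, 7} (by decide) _ ?_) ?_ ?_ ?_ ?_ ?_ ?_ ?_ ?_ ?_ ?_ ?_ ?_ <;>
        first | linarith | (intro v; fin_cases v <;> simp)
  -- Each of two representations minimizes the height, so they are equal.
  · intro w u hw hu
    obtain ⟨s, hs, hws⟩ := hw.supp
    obtain ⟨t, ht, hut⟩ := hu.supp
    obtain ⟨-, h3⟩ := height_le_of_mem_sevenTetrahedra hs hws hu.nonneg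
      (hw.sum_eq.trans hu.sum_eq.symm) (hw.point.trans hu.point.symm)
    obtain ⟨h4, -⟩ := height_le_of_mem_sevenTetrahedra ht hut hw.nonneg
      (hu.sum_eq.trans hw.sum_eq.symm) (hu.point.trans hw.point.symm)
    exact (h3 h4).symm

/-- The labelling of the vertices of the trapezoid prism by the vertices of the cube. -/
def prismLabel (v : Fin 8) : Fin 3 → Bool :=
  ![decide (4 ≤ v.val), decide (v.val % 2 = 1), decide (v.val / 2 % 2 = 1)]

theorem prismLabel_bijective : Function.Bijective prismLabel := by
  refine (Fintype.bijective_iff_injective_and_card _).2 ⟨?_, by simp⟩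
  unfold Function.Injective
  decide

theorem hasCubeTriangulation_three : HasCubeTriangulation 3 7 := by
  let e := Equiv.ofBijective prismLabel prismLabel_bijective
  -- These are the unit-cube inequalities, except that the facet `(1, true)` is tilted to `x 1 - x 2
  -- ≤ 1`.
  let f : Fin 3 × Bool → (Fin 3 → ℝ) →ₗ[ℝ] ℝ := fun j =>
    (if j.2 then (1 : ℝ) else -1) • LinearMap.proj j.1 -
      (if j.1 = 1 ∧ j.2 then (1 : ℝ) else 0) • LinearMap.proj 2
  let c : Fin 3 × Bool → ℝ := fun j => if j.2 then 1 else 0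
  have hc : ∀ (v : Fin 8) (j : Fin 3 × Bool), f j (trapezoidPrism v) ≤ c j ∧
      (f j (trapezoidPrism v) = c j ↔ prismLabel v j.1 = j.2) := by
    intro v j
    -- All data are integers, so the incidences reduce to a finite check by `decide`.
    have h1 : f j (trapezoidPrism v) = (((if j.2 then 1 else -1) * trapezoidPrismCoord v j.1 -
        (if j.1 = 1 ∧ j.2 then 1 else 0) * trapezoidPrismCoord v 2 : ℤ) : ℝ) := by
      push_cast
      rfl
    have h2 : c j = ((if j.2 then 1 else 0 : ℤ) : ℝ) := by push_cast; rfl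
    rw [h1, h2, Int.cast_le, Int.cast_inj]
    clear h1 h2
    revert v j
    decide
  refine ⟨fun v => LinearEquiv.refl ℝ _ (trapezoidPrism (e.symm v)), f, c,
    sevenTetrahedra.map e.finsetCongr.toEmbedding, ?_, ?_, ?_, ?_, ?_⟩
  · intro v j
    exact (hc _ j).1
  · intro v j
    have h := (hc (e.symm v) j).2
    rwa [show prismLabel (e.symm v) = v from e.apply_symm_apply v] at h
  · intro x hx
    refine existsUnique_isRep_map e (LinearEquiv.refl ℝ _) (existsUnique_isRep_sevenTetrahedra
      ?_ ?_ ?_ ?_ ?_ ?_)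
    · simpa [f, c] using hx (0, false)
    · simpa [f, c] using hx (0, true)
    · simpa [f, c] using hx (1, false)
    · simpa [f, c] using hx (1, true)
    · simpa [f, c] using hx (2, false)
    · simpa [f, c] using hx (2, true)
  · intro s hs
    obtain ⟨s, hs', rfl⟩ := Finset.mem_map.1 hs
    have : ∀ s ∈ sevenTetrahedra, s.card = 4 := by
      intro s hs
      simp only [sevenTetrahedra, Finset.mem_insert, Finset.mem_singleton] at hs
      rcases hs with rfl | rfl | rfl | rfl | rfl | rfl | rfl <;> rfl
    simp [this s hs']
  · rw [Finset.card_map]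
    decide

/-! ### Assembling the bound -/

/-- A segment factor leaves the ratio of size to factorial unchanged and a prism factor multiplies
it by `7/6`; the identity is kept free of division. -/
theorem exists_hasCubeTriangulation (k r : ℕ) :
    ∃ n, HasCubeTriangulation (r + 3 * k) n ∧ n * 6 ^ k = 7 ^ k * (r + 3 * k).factorial := by
  induction k with
  | zero =>
    induction r with
    | zero => exact ⟨1, hasCubeTriangulation_zero, by simp⟩
    | succ r ih =>
      obtain ⟨n, hn, e⟩ := ih
      refine ⟨_, hn.prod hasCubeTriangulation_one, ?_⟩
      simp only [mul_zero, add_zero, pow_zero, mul_one, one_mul] at e ⊢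
      rw [e, Nat.choose_symm_of_eq_add (b := 1) rfl, Nat.choose_one_right, Nat.factorial_succ,
        mul_comm]
  | succ k ih =>
    obtain ⟨n, hn, e⟩ := ih
    refine ⟨_, hn.prod hasCubeTriangulation_three, ?_⟩
    have h := Nat.add_choose_mul_factorial_mul_factorial (r + 3 * k) 3
    rw [show Nat.factorial 3 = 6 from rfl] at h
    rw [Nat.choose_symm_add, show r + 3 * (k + 1) = r + 3 * k + 3 from by ring, ← h, pow_succ, pow_succ]
    calc n * 7 * (r + 3 * k + 3).choose 3 * (6 ^ k * 6)
        = (n * 6 ^ k) * 7 * (r + 3 * k + 3).choose 3 * 6 := by ring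
      _ = _ := by rw [e]; ring

theorem mainTheorem6 :
    ∃ c : ℝ, 1.031 ≤ c ∧ ∀ d : ℕ, 2 < d →
      IsGreatest (cubeTriangulationSizes d) (maxCubeTriangulationSize d) ∧
        c ^ d * (Nat.factorial d : ℝ) ≤ (maxCubeTriangulationSize d : ℝ) := by
  refine ⟨1.031, le_rfl, fun d hd => ?_⟩
  obtain ⟨n, hn, e⟩ := exists_hasCubeTriangulation (d / 3) (d % 3)
  rw [Nat.mod_add_div] at hn e
  have hbdd := bddAbove_cubeTriangulationSizes d
  refine ⟨⟨Nat.sSup_mem ⟨n, hn.mem⟩ hbdd, fun m hm => le_csSup hbdd hm⟩, ?_⟩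
  refine le_trans ?_ (Nat.cast_le.2 (le_csSup hbdd hn.mem) : (n : ℝ) ≤ _)
  -- The worst case is `d = 5`, with one prism and two segments; the constant works because `1.031 ^
  -- 5 < 7/6`.
  have hk : d ≤ 5 * (d / 3) := by omega
  have hc : (1.031 : ℝ) ^ d ≤ (7 / 6) ^ (d / 3) :=
    calc (1.031 : ℝ) ^ d ≤ 1.031 ^ (5 * (d / 3)) := pow_le_pow_right₀ (by norm_num) hk
      _ = (1.031 ^ 5) ^ (d / 3) := pow_mul _ _ _
      _ ≤ (7 / 6) ^ (d / 3) := by gcongr; norm_num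
  have e' : (n : ℝ) * 6 ^ (d / 3) = 7 ^ (d / 3) * d.factorial := by exact_mod_cast e
  have hn' : (n : ℝ) = (7 / 6) ^ (d / 3) * d.factorial := by
    rw [div_pow]
    field_simp
    linarith
  rw [hn']
  gcongr
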